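/- Consider the state-space model $x_t=\mathcal M_{t-1}(x_{t-1})+\eta_t$, $y_t=\mathcal H_t(x_t)+\varepsilon_t$ ($t=1,\dots,T$) with measurable $\mathcal M_{t}:\mathbb R^{d_{x_t}}\to\mathbb R^{d_{x_{t+1}}}$, $\mathcal H_t:\mathbb R^{d_{x_t}}\to\mathbb R^{d_{y_t}}$, independent noises with Lebesgue densities $p_{\eta_t},p_{\varepsilon_t}$, and fixed observations $y_1,\dots,y_T$. Let $Q_0$ be the law of $x_0$, let the prior $P_t=(\mathcal M_{t-1\#}Q_{t-1})*p_{\eta_t}$ be the law of $x_t$ given $y_{1:t-1}$, and let the posterior $Q_t$, given by $\mathrm dQ_t/\mathrm dP_t(x)\propto p_{\varepsilon_t}(y_t-\mathcal H_t(x))$, be the law of $x_t$ given $y_{1:t}$. Let $w_t(x)=a_t\,p_{\varepsilon_t}(y_t-\mathcal H_t(x))$ with constants $a_t>0$ (the common weight carried over by the resampled particles). Assume, for all $t=1,\dots,T$: (1) $\mathcal M_t,\mathcal H_t$ are continuous and $p_{\eta_t},p_{\varepsilon_t}$ are $C^1$; (2) $\|w_t\|_\infty\le B$; (3) $\mathbb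 E\|\eta_t\|^2,\mathbb E\|\varepsilon_t\|^2<\infty$; (4) $w_t$ is differentiable with $\|\nabla w_t\|_2\le\beta$; (5) $P_t$ is strongly log-concave with parameter $\gamma_t>0$. Fix $t\in\{1,\dots,T\}$, write $d=d_{x_t}$, and let $\mathcal F_D=\{f:\|f\|_{\mathcal H}\le1\}$ be the unit ball of the RKHS $\mathcal H$ of the linear kernel $K(x,y)=x^\top y+c$ on $\mathbb R^d$; assume that (4) also holds for every $f\in\mathcal F_D$, i.e. $f$ is differentiable with $\|\nabla f\|_2\le\beta$. Let $\hat P_t$ be a probability measure on $\mathbb R^d$ (the estimated prior). Assume that $\hat P_t$ and $P_t$ are sub-Gaussian with parameter $\sigma$, i.e. $\mathbb E\exp(\langle u,X\rangle^2/\sigma^2)\le2$ for all unit vectors $u$, and that $\mathbb E_{P_t}w_t\ge\kappa>0$. Let $\mathcal G_t=\Phi(L,W,S,R)$ be the class of fully connected ReLU networks $\mathbb R^d\to\mathbb R^d$ with $L\ge1$ layers, widths $W$, at most $S$ nonzero weights and biases, all of absolute value at most $R$. Suppose that $R\ge\|\mathbb E_{Y\sim Q_t}Y\|_\infty$ and that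 $S$ is at least the number of nonzero coordinates of $\mathbb E_{Y\sim Q_t}Y$. Let $x_1,\dots,x_{N_1}$ be i.i.d. from $\hat P_t$ and $x'_1,\dots,x'_{N_2}$ i.i.d. from $P_t$, with $N_1\ge2$, $N_2\ge1$, and let $$\hat G_t\in\operatorname*{arg\,min}_{G\in\mathcal G_t}\ \sup_{f\in\mathcal F_D}\left|\frac1{N_1}\sum_{i=1}^{N_1}f(G(x_i))-\sum_{j=1}^{N_2}\frac{w_t(x'_j)}{\sum_{k=1}^{N_2}w_t(x'_k)}f(x'_j)\right|.$$ Then the expectation over the two samples satisfies $$\mathbb E\left\|\mathbb E_{X\sim\hat G_{t\#}\hat P_t}X-\mathbb E_{Y\sim Q_t}Y\right\|_2\le C\,d\left(\frac{\log N_1}{\sqrt{N_1}}+\frac1{\sqrt{N_2}}\right),$$ where $C$ depends only on $L,S,R,\sigma,B,\kappa$ (in particular not on $N_1$, $N_2$, $d$, $W$). -/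

import Mathlib

open MeasureTheory ProbabilityTheory

noncomputable section

/-- Euclidean space `ℝⁿ`. -/
abbrev Euc (n : ℕ) : Type := EuclideanSpace ℝ (Fin n)

/-! ### State-space models, priors and posteriors -/

/-- `p` is a probability density on `ℝⁿ` with respect to Lebesgue measure. -/
structure IsProbDensity {n : ℕ} (p : Euc n → ℝ) : Prop where
  measurable : Measurable p
  nonneg : ∀ x, 0 ≤ p x
  lintegral_eq_one : ∫⁻ x, ENNReal.ofReal (p x) = 1

/-- The measure on `ℝⁿ` with Lebesgue density `p`. -/
def densityMeasure {n : ℕ} (p : Euc n → ℝ) : Measure (Euc n) :=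
  volume.withDensity fun x => ENNReal.ofReal (p x)

/-- The state-space model `x_{t+1} = M_t(x_t) + η_{t+1}`, `y_t = H_t(x_t) + ε_t`, where `x_0` has
law `init`, the noises are mutually independent, `η_t` has density `pη t`, and `ε_t` has density
`pε t`. (The values `pη 0`, `H 0`, `pε 0` play no role: noise and observations start at time 1.) -/
structure StateSpaceModel where
  dx : ℕ → ℕ
  dy : ℕ → ℕ
  M : ∀ t, Euc (dx t) → Euc (dx (t + 1))
  H : ∀ t, Euc (dx t) → Euc (dy t)
  pη : ∀ t, Euc (dx t) → ℝ
  pε : ∀ t, Euc (dy t) → ℝ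
  init : Measure (Euc (dx 0))
  measurable_M : ∀ t, Measurable (M t)
  measurable_H : ∀ t, Measurable (H t)
  density_pη : ∀ t, IsProbDensity (pη t)
  density_pε : ∀ t, IsProbDensity (pε t)
  isProbabilityMeasure_init : IsProbabilityMeasure init

/-- Bayes' rule: the law with density proportional to `ℓ` with respect to `P`. -/
def bayesUpdate {n : ℕ} (ℓ : Euc n → ℝ) (P : Measure (Euc n)) : Measure (Euc n) :=
  (∫⁻ x, ENNReal.ofReal (ℓ x) ∂P)⁻¹ • P.withDensity fun x => ENNReal.ofReal (ℓ x)

namespace StateSpaceModel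

/-- The likelihood `x ↦ p_{ε_t}(y_t - H_t(x))` of the observation at time `t`. -/
def likelihood (𝒮 : StateSpaceModel) (y : ∀ t, Euc (𝒮.dy t)) (t : ℕ) (x : Euc (𝒮.dx t)) : ℝ :=
  𝒮.pε t (y t - 𝒮.H t x)

/-- The law of `M_t(X) + η_{t+1}` when `X` has law `Q` and is independent of `η_{t+1}`. -/
def forecast (𝒮 : StateSpaceModel) (t : ℕ) (Q : Measure (Euc (𝒮.dx t))) :
    Measure (Euc (𝒮.dx (t + 1))) :=
  (Q.map (𝒮.M t)).conv (densityMeasure (𝒮.pη (t + 1)))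

/-- The posterior `Q_t`, the law of `x_t` given `y_1, …, y_t`. -/
def posterior (𝒮 : StateSpaceModel) (y : ∀ t, Euc (𝒮.dy t)) : ∀ t, Measure (Euc (𝒮.dx t))
  | 0 => 𝒮.init
  | t + 1 => bayesUpdate (𝒮.likelihood y (t + 1)) (𝒮.forecast t (posterior 𝒮 y t))

/-- The prior `P_t`, the law of `x_t` given `y_1, …, y_{t-1}`. -/
def prior (𝒮 : StateSpaceModel) (y : ∀ t, Euc (𝒮.dy t)) : ∀ t, Measure (Euc (𝒮.dx t))
  | 0 => 𝒮.init
  | t + 1 => 𝒮.forecast t (𝒮.posterior y t)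

/-- The importance weight `w_t(x) = a_t p_{ε_t}(y_t - H_t(x))`, where the positive constant `a_t`
is the common weight that the (resampled) particles carry over from the previous time step. -/
def weight (𝒮 : StateSpaceModel) (y : ∀ t, Euc (𝒮.dy t)) (a : ℕ → ℝ) (t : ℕ)
    (x : Euc (𝒮.dx t)) : ℝ :=
  a t * 𝒮.likelihood y t x

/-! ### Regularity assumptions -/

/-- The operators are continuous and the noise densities continuously differentiable. -/
def RegularityAssumption (𝒮 : StateSpaceModel) (T : ℕ) : Prop :=
  ∀ t ∈ Set.Icc 1 T, Continuous (𝒮.M t) ∧ Continuous (𝒮.H t) ∧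
    ContDiff ℝ 1 (𝒮.pη t) ∧ ContDiff ℝ 1 (𝒮.pε t)

/-- The weights are bounded by `B`. -/
def BoundedWeights (𝒮 : StateSpaceModel) (y : ∀ t, Euc (𝒮.dy t)) (a : ℕ → ℝ) (T : ℕ) (B : ℝ) :
    Prop :=
  ∀ t ∈ Set.Icc 1 T, ∀ x, |𝒮.weight y a t x| ≤ B

/-- The noises have finite second moments. -/
def FiniteNoiseVariance (𝒮 : StateSpaceModel) (T : ℕ) : Prop :=
  ∀ t ∈ Set.Icc 1 T, ∫⁻ x, ‖x‖ₑ ^ 2 ∂densityMeasure (𝒮.pη t) < ⊤ ∧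
    ∫⁻ x, ‖x‖ₑ ^ 2 ∂densityMeasure (𝒮.pε t) < ⊤

end StateSpaceModel

/-- `f` is differentiable with gradient bounded by `β`. -/
def HasGradientBound {n : ℕ} (f : Euc n → ℝ) (β : ℝ) : Prop :=
  Differentiable ℝ f ∧ ∀ x, ‖gradient f x‖ ≤ β

/-- `P` is a `γ`-strongly log-concave distribution: a probability measure with density `exp (-ψ)`
on a convex set `K` (and `0` outside), where `ψ` is `γ`-strongly convex on `K`. -/
def IsStronglyLogConcave {n : ℕ} (P : Measure (Euc n)) (γ : ℝ) : Prop :=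
  IsProbabilityMeasure P ∧ ∃ (K : Set (Euc n)) (ψ : Euc n → ℝ), StrongConvexOn K γ ψ ∧
    P = (volume.restrict K).withDensity fun x => ENNReal.ofReal (Real.exp (-ψ x))

/-- `P` is sub-Gaussian with parameter `σ`: all one-dimensional marginals `⟨u, X⟩`, `‖u‖ = 1`,
have `ψ₂`-norm at most `σ`. -/
def IsSubGaussian {n : ℕ} (P : Measure (Euc n)) (σ : ℝ) : Prop :=
  0 < σ ∧ ∀ u : Euc n, ‖u‖ = 1 →
    ∫⁻ x, ENNReal.ofReal (Real.exp (inner ℝ u x ^ 2 / σ ^ 2)) ∂P ≤ 2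

/-! ### Test functions -/

/-- `𝓗` is the reproducing kernel Hilbert space of the linear kernel `K(x, y) = xᵀy + c`. -/
def HasLinearKernel {n : ℕ} (𝓗 : Type*) [NormedAddCommGroup 𝓗] [InnerProductSpace ℝ 𝓗]
    [CompleteSpace 𝓗] [RKHS ℝ 𝓗 (Euc n) ℝ] (c : ℝ) : Prop :=
  ∀ x y : Euc n, RKHS.kernel 𝓗 x y 1 = inner ℝ x y + c

/-- The unit ball of a reproducing kernel Hilbert space, as a set of functions. -/
def rkhsUnitBall {n : ℕ} (𝓗 : Type*) [NormedAddCommGroup 𝓗] [InnerProductSpace ℝ 𝓗]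
    [RKHS ℝ 𝓗 (Euc n) ℝ] : Set (Euc n → ℝ) :=
  {f | ∃ h : 𝓗, ‖h‖ ≤ 1 ∧ f = ⇑h}

/-! ### Empirical maximum mean discrepancy -/

/-- The self-normalized importance sampling estimate
`∑ j, (w(x'_j) / ∑ k, w(x'_k)) f(x'_j)`. -/
def snisMean {n N : ℕ} (w : Euc n → ℝ) (x' : Fin N → Euc n) (f : Euc n → ℝ) : ℝ :=
  ∑ j, w (x' j) / (∑ k, w (x' k)) * f (x' j)

/-- The empirical maximum mean discrepancy between the transformed particles `G(x_i)` and the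
weighted particles `x'_j`, over the test functions `F`. -/
def empiricalMMD {n N₁ N₂ : ℕ} (F : Set (Euc n → ℝ)) (w : Euc n → ℝ) (x : Fin N₁ → Euc n)
    (x' : Fin N₂ → Euc n) (G : Euc n → Euc n) : ENNReal :=
  ⨆ f ∈ F, ENNReal.ofReal |1 / (N₁ : ℝ) * ∑ i, f (G (x i)) - snisMean w x' f|

/-- `G` minimizes the empirical maximum mean discrepancy over the class `𝒢`. -/
def IsEmpiricalMinimizer {n N₁ N₂ : ℕ} (𝒢 : Set (Euc n → Euc n)) (F : Set (Euc n → ℝ))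
    (w : Euc n → ℝ) (x : Fin N₁ → Euc n) (x' : Fin N₂ → Euc n) (G : Euc n → Euc n) : Prop :=
  G ∈ 𝒢 ∧ ∀ G' ∈ 𝒢, empiricalMMD F w x x' G ≤ empiricalMMD F w x x' G'

/-! ### Neural networks -/

/-- The output of the first `l` layers of the ReLU network with widths `W`, weight matrices `A`
and biases `b`; the layer with index `l` maps `ℝ^(W l)` to `ℝ^(W (l + 1))`, and every layer but
the first one applies ReLU to its input. -/
def reluNet (W : ℕ → ℕ) (A : ∀ l, Matrix (Fin (W (l + 1))) (Fin (W l)) ℝ)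
    (b : ∀ l, Fin (W (l + 1)) → ℝ) (x : Fin (W 0) → ℝ) : ∀ l, Fin (W l) → ℝ
  | 0 => x
  | 1 => (A 0).mulVec x + b 0
  | l + 2 => (A (l + 1)).mulVec (fun i => max (reluNet W A b x (l + 1) i) 0) + b (l + 1)

/-- The class `Φ(L, W, S, R)` of ReLU networks `ℝⁿ → ℝⁿ` with `L` layers, widths
`W 0 = n, W 1, …, W L = n`, at most `S` nonzero weights and biases, all bounded by `R`. -/
def reluClass (n L : ℕ) (W : ℕ → ℕ) (S : ℕ) (R : ℝ) : Set (Euc n → Euc n) :=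
  {G | ∃ (A : ∀ l, Matrix (Fin (W (l + 1))) (Fin (W l)) ℝ) (b : ∀ l, Fin (W (l + 1)) → ℝ)
      (hin : W 0 = n) (hout : W L = n),
    (∑ l ∈ Finset.range L,
      ({p : Fin (W (l + 1)) × Fin (W l) | A l p.1 p.2 ≠ 0}.ncard + {i | b l i ≠ 0}.ncard)) ≤ S ∧
    (∀ l < L, (∀ i j, |A l i j| ≤ R) ∧ ∀ i, |b l i| ≤ R) ∧
    ∀ (x : Euc n) (i : Fin n),
      G x i = reluNet W A b (fun j => x (Fin.cast hin j)) L (Fin.cast hout.symm i)}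

end

/-! For the linear kernel, the functions in the unit ball of the RKHS are affine with slope at most
one, so the empirical discrepancy of `G` is governed by `‖e - s‖`, where `e` is the empirical mean
of `G(x_i)` and `s` is the self-normalized weighted mean of the `x'_j`. The constant network with
value `m`, the posterior mean, lies in the class: all weights vanish and the last bias is `m`.
Minimality therefore gives `‖e - s‖ ≤ ‖m - s‖`, and with `v = ∫ G dPhat` one gets `‖v - m‖ ≤ ‖e - v‖
+ 2 ‖s - m‖`. This is `norm_sub_le_of_isEmpiricalMinimizer` combined with `norm_sub_le_of_weights`.

The term `‖s - m‖` is a ratio. Its numerator `∑ w(x'_j)(x'_j - m)` is a sum of independent centered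
variables, of mean size `O(√N₂)` per coordinate. Its denominator is at least `N₂κ/2` unless the
total weight deviates by that much from its mean; in that case an a priori bound on `‖v - m‖` is
paid for by the deviation.

The term `‖e - v‖` needs a bound uniform over the class, since the network depends on the sample.
Symmetrization reduces it to Rademacher sums, which are peeled layer by layer with the contraction
principle (`exists_measurable_bound_neuron`). Sparsity bounds the `ℓ¹`-norm of each weight row by `S
* R` and the number of active outputs by `S`, so widths do not enter; the dimension comes from the
input coordinates. This gives the rate `1/√N₁`, and `log N₁ ≥ log 2` turns it into the stated form.
-/

noncomputable section

/-! ### Rademacher sums and the contraction principle -/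

/-- The signed sum `∑ i, ε i * v i`. -/
def signSum {N : ℕ} (ε : Fin N → ℤˣ) (v : Fin N → ℝ) : ℝ := ∑ i, ((ε i : ℤ) : ℝ) * v i

/-- The sum over all sign vectors of the largest absolute signed sum of a family of vectors. -/
def rademacherSum {ι : Type*} {N : ℕ} (v : ι → Fin N → ℝ) : ENNReal :=
  ∑ ε : Fin N → ℤˣ, ⨆ j, ‖signSum ε (v j)‖ₑ

/-- Flipping the sign at the index `a`. -/
def flipSign {N : ℕ} (a : Fin N) : Equiv.Perm (Fin N → ℤˣ) :=
  Function.Involutive.toPerm (fun ε => Function.update ε a (-ε a)) fun ε => by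
    ext i
    by_cases h : i = a
    · subst h; simp
    · simp [h]

lemma flipSign_apply {N : ℕ} (a : Fin N) (ε : Fin N → ℤˣ) :
    flipSign a ε = Function.update ε a (-ε a) := rfl

lemma signSum_eq_add {N : ℕ} (ε : Fin N → ℤˣ) (v : Fin N → ℝ) (a : Fin N) :
    signSum ε v = ∑ i ∈ Finset.univ.erase a, ((ε i : ℤ) : ℝ) * v i + ((ε a : ℤ) : ℝ) * v a := by
  unfold signSum
  rw [Finset.sum_erase_add _ _ (Finset.mem_univ a)]

lemma signSum_flipSign {N : ℕ} (ε : Fin N → ℤˣ) (v : Fin N → ℝ) (a : Fin N) :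
    signSum (flipSign a ε) v =
      ∑ i ∈ Finset.univ.erase a, ((ε i : ℤ) : ℝ) * v i - ((ε a : ℤ) : ℝ) * v a := by
  rw [signSum_eq_add _ _ a, flipSign_apply]
  have : ∀ i ∈ Finset.univ.erase a, ((Function.update ε a (-ε a) i : ℤ) : ℝ) * v i
      = ((ε i : ℤ) : ℝ) * v i := fun i hi => by
    rw [Function.update_of_ne (Finset.ne_of_mem_erase hi)]
  rw [Finset.sum_congr rfl this]
  simp [sub_eq_add_neg]

lemma abs_intUnit (u : ℤˣ) : |((u : ℤ) : ℝ)| = 1 := by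
  rcases Int.units_eq_one_or u with h | h <;> simp [h]

/-- The contraction principle for a single sign. At maximizers `s`, `t` of the two suprema on the
left, the left side is at most `u s + u t + |q s - q t|`; the sign of `q s - q t` decides which of
`s`, `t` to insert into which supremum on the right. Finiteness makes the suprema attained. -/
lemma iSup_add_iSup_sub_le {ι : Type*} [Finite ι] [Nonempty ι] (u p q : ι → ℝ)
    (h : ∀ s t, |p s - p t| ≤ |q s - q t|) :
    (⨆ t, (u t + p t)) + (⨆ t, (u t - p t)) ≤ (⨆ t, (u t + q t)) + (⨆ t, (u t - q t)) := by
  obtain ⟨s, hs⟩ := exists_eq_ciSup_of_finite (f := fun t => u t + p t)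
  obtain ⟨t, ht⟩ := exists_eq_ciSup_of_finite (f := fun t => u t - p t)
  rw [← hs, ← ht]
  have h1 := fun r => le_ciSup (Set.finite_range (fun t => u t + q t)).bddAbove r
  have h2 := fun r => le_ciSup (Set.finite_range (fun t => u t - q t)).bddAbove r
  have h3 := (le_abs_self _).trans (h s t)
  have := h1 s
  have := h1 t
  have := h2 s
  have := h2 t
  rcases abs_cases (q s - q t) with ⟨h4, _⟩ | ⟨h4, _⟩ <;> rw [h4] at h3 <;> linarith

lemma sum_iSup_signSum_update_le {ι : Type*} [Finite ι] [Nonempty ι] {N : ℕ}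
    (v : ι → Fin N → ℝ) {φ : ℝ → ℝ} (hφ : ∀ s t, |φ s - φ t| ≤ |s - t|) (a : Fin N) :
    ∑ ε : Fin N → ℤˣ, ⨆ t, signSum ε (Function.update (v t) a (φ (v t a))) ≤
      ∑ ε : Fin N → ℤˣ, ⨆ t, signSum ε (v t) := by
  have key : ∀ F : (Fin N → ℤˣ) → ℝ, ∑ ε, (F ε + F (flipSign a ε)) = 2 * ∑ ε, F ε := fun F => by
    rw [Finset.sum_add_distrib, Equiv.sum_comp (flipSign a) F, two_mul]
  -- Doubling pairs each sign vector with its flip at `a`, so that all other signs are frozen and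
  -- the one-sign inequality applies.
  refine le_of_mul_le_mul_left ?_ (zero_lt_two' ℝ)
  rw [← key, ← key]
  refine Finset.sum_le_sum fun ε _ => ?_
  simp only [signSum_flipSign]
  simp only [signSum_eq_add ε _ a, Function.update_self]
  have : ∀ t, ∑ i ∈ Finset.univ.erase a,
      ((ε i : ℤ) : ℝ) * Function.update (v t) a (φ (v t a)) i =
      ∑ i ∈ Finset.univ.erase a, ((ε i : ℤ) : ℝ) * v t i := fun t =>
    Finset.sum_congr rfl fun i hi => by
      rw [Function.update_of_ne (Finset.ne_of_mem_erase hi)]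
  simp only [this]
  refine iSup_add_iSup_sub_le _ _ _ fun s t => ?_
  rw [← mul_sub, ← mul_sub, abs_mul, abs_mul, abs_intUnit, one_mul, one_mul]
  exact hφ _ _

/-- **Contraction principle** (without absolute values). -/
lemma sum_iSup_signSum_comp_le {ι : Type*} [Finite ι] [Nonempty ι] {N : ℕ}
    (v : ι → Fin N → ℝ) {φ : ℝ → ℝ} (hφ : ∀ s t, |φ s - φ t| ≤ |s - t|) :
    ∑ ε : Fin N → ℤˣ, ⨆ t, signSum ε (fun i => φ (v t i)) ≤
      ∑ ε : Fin N → ℤˣ, ⨆ t, signSum ε (v t) := by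
  -- The map `φ` is introduced one coordinate at a time; `A` is the set of coordinates already
  -- treated.
  have key : ∀ A : Finset (Fin N),
      ∑ ε : Fin N → ℤˣ, ⨆ t, signSum ε (fun i => if i ∈ A then φ (v t i) else v t i) ≤
      ∑ ε : Fin N → ℤˣ, ⨆ t, signSum ε (v t) := fun A => by
    induction A using Finset.induction_on with
    | empty => simp
    | insert a A ha ih =>
      refine le_trans (le_of_eq ?_) ((sum_iSup_signSum_update_le
        (fun t i => if i ∈ A then φ (v t i) else v t i) hφ a).trans ih)
      refine Finset.sum_congr rfl fun ε _ => ?_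
      congr 1
      ext t
      congr 1
      ext i
      by_cases h : i = a
      · subst h; simp [ha]
      · simp [h]
  simpa using key Finset.univ

lemma signSum_zero {N : ℕ} (ε : Fin N → ℤˣ) : signSum ε (fun _ => 0) = 0 := by simp [signSum]

lemma signSum_neg_left {N : ℕ} (ε : Fin N → ℤˣ) (v : Fin N → ℝ) :
    signSum (-ε) v = - signSum ε v := by simp [signSum]

lemma rademacherSum_comp_le_of_finite {ι : Type*} [Finite ι] {N : ℕ} (v : ι → Fin N → ℝ)
    {φ : ℝ → ℝ} (hφ : ∀ s t, |φ s - φ t| ≤ |s - t|) (h0 : φ 0 = 0) :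
    rademacherSum (fun t i => φ (v t i)) ≤ 2 * rademacherSum v := by
  -- Adjoining the zero vector makes every supremum nonnegative, so an absolute value is bounded by
  -- the supremum at `ε` plus the one at `-ε`. These have equal sums over `ε`, whence the factor 2.
  let w : Option ι → Fin N → ℝ := fun o => o.elim (fun _ => 0) v
  have hbdd : ∀ f : Option ι → ℝ, BddAbove (Set.range f) := fun f => (Set.finite_range f).bddAbove
  have h1 : ∀ ε : Fin N → ℤˣ, (⨆ j, ‖signSum ε (fun i => φ (v j i))‖ₑ) ≤
      ENNReal.ofReal ((⨆ t, signSum ε (fun i => φ (w t i))) +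
        ⨆ t, signSum (-ε) (fun i => φ (w t i))) := fun ε => by
    refine iSup_le fun j => ?_
    rw [Real.enorm_eq_ofReal_abs]
    refine ENNReal.ofReal_le_ofReal ?_
    have a1 := le_ciSup (hbdd fun t => signSum ε (fun i => φ (w t i))) (some j)
    have a2 := le_ciSup (hbdd fun t => signSum ε (fun i => φ (w t i))) none
    have a3 := le_ciSup (hbdd fun t => signSum (-ε) (fun i => φ (w t i))) (some j)
    have a4 := le_ciSup (hbdd fun t => signSum (-ε) (fun i => φ (w t i))) none
    simp only [w, Option.elim, h0, signSum_zero, signSum_neg_left] at a1 a2 a3 a4 ⊢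
    exact abs_le.2 ⟨by linarith, by linarith⟩
  have hnn : ∀ (ψ : ℝ → ℝ), ψ 0 = 0 → ∀ ε : Fin N → ℤˣ,
      0 ≤ ⨆ t, signSum ε (fun i => ψ (w t i)) := fun ψ hψ ε => by
    have := le_ciSup (hbdd fun t => signSum ε (fun i => ψ (w t i))) none
    simpa [w, hψ, signSum_zero] using this
  have h2 : ∀ ε : Fin N → ℤˣ, ENNReal.ofReal (⨆ t, signSum ε (w t)) ≤
      ⨆ j, ‖signSum ε (v j)‖ₑ := fun ε => by
    obtain ⟨s, hs⟩ := exists_eq_ciSup_of_finite (f := fun t => signSum ε (w t))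
    rw [← hs]
    cases s with
    | none => simp [w, signSum_zero]
    | some j =>
      refine le_trans ?_ (le_iSup _ j)
      rw [Real.enorm_eq_ofReal_abs]
      exact ENNReal.ofReal_le_ofReal (le_abs_self _)
  have hneg : ∀ F : (Fin N → ℤˣ) → ℝ, ∑ ε, F (-ε) = ∑ ε, F ε := fun F =>
    Equiv.sum_comp (Equiv.neg _) F
  calc rademacherSum (fun t i => φ (v t i))
      ≤ ∑ ε : Fin N → ℤˣ, ENNReal.ofReal ((⨆ t, signSum ε (fun i => φ (w t i))) +
        ⨆ t, signSum (-ε) (fun i => φ (w t i))) := Finset.sum_le_sum fun ε _ => h1 ε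
    _ = ENNReal.ofReal (2 * ∑ ε : Fin N → ℤˣ, ⨆ t, signSum ε (fun i => φ (w t i))) := by
      rw [← ENNReal.ofReal_sum_of_nonneg fun ε _ => add_nonneg (hnn φ h0 ε) (hnn φ h0 (-ε)),
        Finset.sum_add_distrib, hneg fun ε => ⨆ t, signSum ε (fun i => φ (w t i)), two_mul]
    _ ≤ ENNReal.ofReal (2 * ∑ ε : Fin N → ℤˣ, ⨆ t, signSum ε (w t)) :=
      ENNReal.ofReal_le_ofReal
        (mul_le_mul_of_nonneg_left (sum_iSup_signSum_comp_le w hφ) zero_le_two)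
    _ = 2 * ∑ ε : Fin N → ℤˣ, ENNReal.ofReal (⨆ t, signSum ε (w t)) := by
      rw [ENNReal.ofReal_mul zero_le_two, ENNReal.ofReal_sum_of_nonneg fun ε _ => show 0 ≤ ⨆ t, signSum ε (w t) from hnn id rfl ε]
      simp
    _ ≤ 2 * rademacherSum v := by
      gcongr
      exact Finset.sum_le_sum fun ε _ => h2 ε

/-- **Contraction principle** for Rademacher sums. -/
lemma rademacherSum_comp_le {ι : Type*} {N : ℕ} (v : ι → Fin N → ℝ)
    {φ : ℝ → ℝ} (hφ : ∀ s t, |φ s - φ t| ≤ |s - t|) (h0 : φ 0 = 0) :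
    rademacherSum (fun t i => φ (v t i)) ≤ 2 * rademacherSum v := by
  unfold rademacherSum
  -- Monotone convergence along finite subfamilies reduces the claim to the finite case.
  simp_rw [iSup_eq_iSup_finset (fun t => ‖signSum _ (fun i => φ (v t i))‖ₑ)]
  rw [ENNReal.finsetSum_iSup_of_monotone]
  · refine iSup_le fun A => ?_
    have := rademacherSum_comp_le_of_finite (fun (t : A) => v t) hφ h0
    unfold rademacherSum at this
    simp_rw [iSup_subtype']
    refine this.trans ?_
    gcongr
    exact iSup_comp_le (fun t => ‖signSum _ (v t)‖ₑ) _
  · intro ε A A' hA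
    exact biSup_mono fun i hi => hA hi

/-- Distinct signs are orthogonal: flipping the sign `i` negates `ε i * ε j`, so only the diagonal
terms survive. -/
lemma sum_signSum_sq {N : ℕ} (v : Fin N → ℝ) :
    ∑ ε : Fin N → ℤˣ, signSum ε v ^ 2 = 2 ^ N * ∑ i, v i ^ 2 := by
  have h : ∀ i j : Fin N, ∑ ε : Fin N → ℤˣ, ((ε i : ℤ) : ℝ) * ((ε j : ℤ) : ℝ) =
      if i = j then 2 ^ N else 0 := fun i j => by
    split_ifs with hij
    · subst hij
      have : ∀ ε : Fin N → ℤˣ, ((ε i : ℤ) : ℝ) * ((ε i : ℤ) : ℝ) = 1 := fun ε => by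
        rw [← abs_mul_abs_self, abs_intUnit, one_mul]
      simp [this]
    · have := Equiv.sum_comp (flipSign i) fun ε => ((ε i : ℤ) : ℝ) * ((ε j : ℤ) : ℝ)
      have h2 : ∀ ε : Fin N → ℤˣ, ((flipSign i ε i : ℤ) : ℝ) * ((flipSign i ε j : ℤ) : ℝ) =
          -(((ε i : ℤ) : ℝ) * ((ε j : ℤ) : ℝ)) := fun ε => by
        simp [flipSign_apply, Function.update_of_ne (Ne.symm hij)]
      simp only [h2, Finset.sum_neg_distrib] at this
      linarith
  have h1 : ∀ ε : Fin N → ℤˣ, signSum ε v ^ 2 =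
      ∑ i, ∑ j, (v i * v j) * (((ε i : ℤ) : ℝ) * ((ε j : ℤ) : ℝ)) := fun ε => by
    rw [sq, signSum, Finset.sum_mul_sum]
    exact Finset.sum_congr rfl fun i _ => Finset.sum_congr rfl fun j _ => by ring
  simp_rw [h1]
  rw [Finset.sum_comm]
  simp_rw [Finset.sum_comm (s := (Finset.univ : Finset (Fin N → ℤˣ))), ← Finset.mul_sum, h]
  simp [Finset.mul_sum, sq, mul_comm]

/-- For every `c > 0`, the mean of `|∑ i, ε i * v i|` is at most `(∑ i, v i ^ 2 / c + c) / 2`. -/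
lemma sum_enorm_signSum_le {N : ℕ} (v : Fin N → ℝ) {c : ℝ} (hc : 0 < c) :
    ∑ ε : Fin N → ℤˣ, ‖signSum ε v‖ₑ ≤
      2 ^ N * ENNReal.ofReal (((∑ i, v i ^ 2) / c + c) / 2) := by
  -- Arithmetic-geometric mean in place of Cauchy–Schwarz: the bound is affine in the squares, so it
  -- can later be integrated over the sample with a deterministic `c`.
  have h : ∀ ε : Fin N → ℤˣ, ‖signSum ε v‖ₑ ≤ ENNReal.ofReal ((signSum ε v ^ 2 / c + c) / 2) :=
    fun ε => by
    rw [Real.enorm_eq_ofReal_abs]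
    refine ENNReal.ofReal_le_ofReal ?_
    rw [div_add' _ _ _ hc.ne', div_div, le_div_iff₀ (by positivity), ← sq_abs (signSum ε v)]
    nlinarith [sq_nonneg (|signSum ε v| - c)]
  refine (Finset.sum_le_sum fun ε _ => h ε).trans (le_of_eq ?_)
  rw [← ENNReal.ofReal_sum_of_nonneg fun ε _ => by positivity, ← Finset.sum_div,
    Finset.sum_add_distrib, ← Finset.sum_div, sum_signSum_sq]
  have : (2 : ENNReal) ^ N = ENNReal.ofReal (2 ^ N) := by
    rw [ENNReal.ofReal_pow zero_le_two]; simp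
  rw [this, ← ENNReal.ofReal_mul (by positivity)]
  congr 1
  simp
  ring


/-! ### Symmetrization and moment bounds for product measures -/

lemma measurePreserving_arrowProd {E : Type*} [MeasurableSpace E] (P : Measure E)
    [IsProbabilityMeasure P] (N : ℕ) :
    MeasurePreserving (fun z : Fin N → E × E => ((fun i => (z i).1), (fun i => (z i).2)))
      (Measure.pi fun _ => P.prod P) ((Measure.pi fun _ => P).prod (Measure.pi fun _ => P)) :=
  measurePreserving_arrowProdEquivProdArrow E E (Fin N) (fun _ => P) (fun _ => P)

/-- Swapping the two samples at the indices where the sign is negative. -/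
def swapSamples {E : Type*} {N : ℕ} (ε : Fin N → ℤˣ) (z : Fin N → E × E) (i : Fin N) : E × E :=
  if ε i = 1 then z i else (z i).swap

lemma measurePreserving_swapSamples {E : Type*} [MeasurableSpace E] (P : Measure E)
    [IsProbabilityMeasure P] {N : ℕ} (ε : Fin N → ℤˣ) :
    MeasurePreserving (swapSamples ε) (Measure.pi fun _ : Fin N => P.prod P)
      (Measure.pi fun _ => P.prod P) := by
  refine measurePreserving_pi (fun _ : Fin N => P.prod P) (fun _ => P.prod P)
    (f := fun i z => if ε i = 1 then z else z.swap) fun i => ?_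
  split_ifs
  · exact MeasurePreserving.id _
  · exact Measure.measurePreserving_swap

lemma sum_swapSamples_eq_signSum {E : Type*} {N : ℕ} (ε : Fin N → ℤˣ) (z : Fin N → E × E)
    (g : E → ℝ) :
    ∑ i, (g (swapSamples ε z i).1 - g (swapSamples ε z i).2) =
      signSum ε (fun i => g (z i).1) - signSum ε (fun i => g (z i).2) := by
  unfold signSum swapSamples
  rw [← Finset.sum_sub_distrib]
  refine Finset.sum_congr rfl fun i _ => ?_
  rcases Int.units_eq_one_or (ε i) with h | h
  · simp [h]
  · have : ((-1 : ℤˣ) = 1) = False := by simp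
    simp only [h, this, if_false]
    simp
    ring

lemma measurable_signSum {α : Type*} [MeasurableSpace α] {N : ℕ} (ε : Fin N → ℤˣ)
    {v : α → Fin N → ℝ} (hv : ∀ i, Measurable fun a => v a i) :
    Measurable fun a => signSum ε (v a) := by
  unfold signSum
  fun_prop

/-- **Symmetrization.** -/
lemma lintegral_iSup_enorm_sum_sub_integral_le {E : Type*} [MeasurableSpace E] (P : Measure E)
    [IsProbabilityMeasure P] {ι : Type*} [Countable ι] (g : ι → E → ℝ)
    (hg : ∀ j, Measurable (g j)) (hi : ∀ j, Integrable (g j) P) (N : ℕ) :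
    2 ^ N * ∫⁻ x, ⨆ j, ‖∑ i, (g j (x i) - ∫ e, g j e ∂P)‖ₑ ∂(Measure.pi fun _ : Fin N => P) ≤
      2 * ∫⁻ x, rademacherSum (fun j i => g j (x i)) ∂(Measure.pi fun _ : Fin N => P) := by
  set ν := Measure.pi fun _ : Fin N => P with hν
  set ν₂ := Measure.pi fun _ : Fin N => P.prod P with hν₂
  let D : (Fin N → E × E) → ENNReal := fun z => ⨆ j, ‖∑ i, (g j (z i).1 - g j (z i).2)‖ₑ
  have hD : Measurable D := by
    refine Measurable.iSup fun j => Measurable.enorm ?_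
    have := hg j
    fun_prop
  have hMP := measurePreserving_arrowProd P N
  have hM : Measurable fun p : (Fin N → E) × (Fin N → E) =>
      ⨆ j, ‖∑ i, (g j (p.1 i) - g j (p.2 i))‖ₑ := by
    refine Measurable.iSup fun j => Measurable.enorm ?_
    have := hg j
    fun_prop
  -- Ghost sample: the mean of `g j` is an integral over an independent copy, which is pulled out of
  -- the norm and the supremum.
  have h1 : ∫⁻ x, ⨆ j, ‖∑ i, (g j (x i) - ∫ e, g j e ∂P)‖ₑ ∂ν ≤ ∫⁻ z, D z ∂ν₂ := by
    have e1 : ∫⁻ z, D z ∂ν₂ =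
        ∫⁻ x, ∫⁻ x', ⨆ j, ‖∑ i, (g j (x i) - g j (x' i))‖ₑ ∂ν ∂ν := by
      rw [← lintegral_prod _ hM.aemeasurable, ← hMP.lintegral_comp hM]
    rw [e1]
    refine lintegral_mono fun x => iSup_le fun j => ?_
    have hij : ∀ i : Fin N, Integrable (fun x' : Fin N → E => g j (x i) - g j (x' i)) ν :=
      fun i => (integrable_const _).sub (integrable_comp_eval (hi j))
    have e2 : ∑ i, (g j (x i) - ∫ e, g j e ∂P) =
        ∫ x' : Fin N → E, ∑ i, (g j (x i) - g j (x' i)) ∂ν := by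
      rw [integral_finsetSum _ fun i _ => hij i]
      refine Finset.sum_congr rfl fun i _ => ?_
      rw [integral_sub (integrable_const _) (integrable_comp_eval (hi j)), integral_const,
        probReal_univ, one_smul,
        integral_comp_eval (μ := fun _ : Fin N => P) (hi j).aestronglyMeasurable]
    rw [e2]
    refine (enorm_integral_le_lintegral_enorm _).trans (lintegral_mono fun x' => ?_)
    exact le_iSup (fun j => ‖∑ i, (g j (x i) - g j (x' i))‖ₑ) j
  have hS : ∀ ε : Fin N → ℤˣ, Measurable fun x : Fin N → E =>
      ⨆ j, ‖signSum ε fun i => g j (x i)‖ₑ := fun ε =>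
    Measurable.iSup fun j => (measurable_signSum ε fun i =>
      (hg j).comp (measurable_pi_apply i)).enorm
  -- Swapping the pairs selected by `ε` preserves the law and turns the differences into signed
  -- ones; each of the two samples then contributes the same integral.
  have h2 : ∀ ε : Fin N → ℤˣ, ∫⁻ z, D z ∂ν₂ ≤
      2 * ∫⁻ x, (⨆ j, ‖signSum ε fun i => g j (x i)‖ₑ) ∂ν := fun ε => by
    rw [← (measurePreserving_swapSamples P ε).lintegral_comp hD]
    have h3 : ∀ z, D (swapSamples ε z) ≤ (⨆ j, ‖signSum ε fun i => g j (z i).1‖ₑ) +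
        ⨆ j, ‖signSum ε fun i => g j (z i).2‖ₑ := fun z => by
      refine iSup_le fun j => ?_
      rw [sum_swapSamples_eq_signSum]
      exact enorm_sub_le.trans (add_le_add (le_iSup (fun j => ‖signSum ε fun i => g j (z i).1‖ₑ) j)
        (le_iSup (fun j => ‖signSum ε fun i => g j (z i).2‖ₑ) j))
    have m1 : MeasurePreserving (fun (z : Fin N → E × E) i => (z i).1) ν₂ ν :=
      measurePreserving_fst.comp hMP
    have m2 : MeasurePreserving (fun (z : Fin N → E × E) i => (z i).2) ν₂ ν :=
      measurePreserving_snd.comp hMP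
    refine (lintegral_mono h3).trans (le_of_eq ?_)
    have m1' : Measurable fun z : Fin N → E × E => ⨆ j, ‖signSum ε fun i => g j (z i).1‖ₑ :=
      (hS ε).comp m1.measurable
    rw [lintegral_add_left m1', two_mul]
    congr 1
    · exact m1.lintegral_comp (hS ε)
    · exact m2.lintegral_comp (hS ε)
  calc 2 ^ N * ∫⁻ x, ⨆ j, ‖∑ i, (g j (x i) - ∫ e, g j e ∂P)‖ₑ ∂ν
      ≤ 2 ^ N * ∫⁻ z, D z ∂ν₂ := by gcongr
    _ = ∑ ε : Fin N → ℤˣ, ∫⁻ z, D z ∂ν₂ := by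
      simp
    _ ≤ ∑ ε : Fin N → ℤˣ, 2 * ∫⁻ x, (⨆ j, ‖signSum ε fun i => g j (x i)‖ₑ) ∂ν :=
      Finset.sum_le_sum fun ε _ => h2 ε
    _ = 2 * ∫⁻ x, rademacherSum (fun j i => g j (x i)) ∂ν := by
      rw [← Finset.mul_sum, ← lintegral_finsetSum _ fun ε _ => hS ε]
      rfl

lemma lintegral_enorm_le_of_integral_sq_le {α : Type*} [MeasurableSpace α] {P : Measure α}
    [IsProbabilityMeasure P] {f : α → ℝ} {c : ℝ} (hc : 0 < c)
    (hi : Integrable (fun x => f x ^ 2) P) (h : ∫ x, f x ^ 2 ∂P ≤ c ^ 2) :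
    ∫⁻ x, ‖f x‖ₑ ∂P ≤ ENNReal.ofReal c := by
  have h1 : ∀ x, ‖f x‖ₑ ≤ ENNReal.ofReal ((f x ^ 2 / c + c) / 2) := fun x => by
    rw [Real.enorm_eq_ofReal_abs]
    refine ENNReal.ofReal_le_ofReal ?_
    rw [div_add' _ _ _ hc.ne', div_div, le_div_iff₀ (by positivity), ← sq_abs (f x)]
    nlinarith [sq_nonneg (|f x| - c)]
  refine (lintegral_mono h1).trans ?_
  have hint : Integrable (fun x => (f x ^ 2 / c + c) / 2) P :=
    ((hi.div_const c).add (integrable_const c)).div_const 2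
  rw [← ofReal_integral_eq_lintegral_ofReal hint (.of_forall fun x => by positivity)]
  refine ENNReal.ofReal_le_ofReal ?_
  rw [integral_div, integral_add (hi.div_const c) (integrable_const c), integral_div,
    integral_const, probReal_univ, one_smul, div_add' _ _ _ hc.ne', div_div,
    div_le_iff₀ (by positivity)]
  nlinarith

/-- The mean absolute value of a sum of `N` independent centered variables. -/
lemma lintegral_enorm_sum_le {E : Type*} [MeasurableSpace E] (P : Measure E)
    [IsProbabilityMeasure P] {f : E → ℝ} (hf : MemLp f 2 P) (h0 : ∫ x, f x ∂P = 0)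
    {c : ℝ} (hc : 0 < c) (h : ∫ x, f x ^ 2 ∂P ≤ c ^ 2) {N : ℕ} (hN : 1 ≤ N) :
    ∫⁻ x, ‖∑ i, f (x i)‖ₑ ∂(Measure.pi fun _ : Fin N => P) ≤
      ENNReal.ofReal (Real.sqrt N * c) := by
  have hN0 : (0 : ℝ) < N := by exact_mod_cast hN
  have hLp : ∀ i : Fin N, MemLp (fun x : Fin N → E => f (x i)) 2 (Measure.pi fun _ : Fin N => P) :=
    fun i => hf.comp_measurePreserving (measurePreserving_eval (fun _ : Fin N => P) i)
  have hsum : MemLp (fun x : Fin N → E => ∑ i, f (x i)) 2 (Measure.pi fun _ : Fin N => P) :=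
    memLp_finsetSum _ fun i _ => hLp i
  refine lintegral_enorm_le_of_integral_sq_le (by positivity)
    hsum.integrable_sq ?_
  have hv := variance_sum_pi (μ := fun _ : Fin N => P) (X := fun _ => f) fun _ => hf
  have hm : ∫ x : Fin N → E, ∑ i, f (x i) ∂(Measure.pi fun _ : Fin N => P) = 0 := by
    rw [integral_finsetSum _ fun i _ => (hLp i).integrable one_le_two]
    refine Finset.sum_eq_zero fun i _ => ?_
    rw [integral_comp_eval (μ := fun _ : Fin N => P) hf.aestronglyMeasurable, h0]
  have e : (∑ i : Fin N, fun ω : Fin N → E => f (ω i)) = fun x => ∑ i, f (x i) := by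
    ext x; simp
  rw [e, variance_of_integral_eq_zero hsum.aestronglyMeasurable.aemeasurable hm] at hv
  rw [hv, variance_of_integral_eq_zero hf.aestronglyMeasurable.aemeasurable h0, mul_pow,
    Real.sq_sqrt hN0.le]
  simp only [Finset.sum_const, Finset.card_univ, Fintype.card_fin, nsmul_eq_mul]
  gcongr


/-! ### Uniform laws of large numbers for ReLU networks -/

/-- The weight matrices and biases of networks with widths `W`. -/
abbrev NetParams (W : ℕ → ℕ) : Type :=
  (∀ l, Matrix (Fin (W (l + 1))) (Fin (W l)) ℝ) × (∀ l, Fin (W (l + 1)) → ℝ)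

/-- Supplies the countable dense set of networks that makes a supremum over the class measurable. -/
instance (W : ℕ → ℕ) : SecondCountableTopology (NetParams W) :=
  inferInstanceAs (SecondCountableTopology
    ((∀ l, Fin (W (l + 1)) → Fin (W l) → ℝ) × (∀ l, Fin (W (l + 1)) → ℝ)))

/-- The output of neuron `k` of layer `l`. -/
def neuron {W : ℕ → ℕ} (θ : NetParams W) (l : ℕ) (k : Fin (W l)) (x : Fin (W 0) → ℝ) : ℝ :=
  reluNet W θ.1 θ.2 x l k

/-- The activation applied to the output of layer `l`. -/
def activation : ℕ → ℝ → ℝ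
  | 0, s => s
  | _ + 1, s => max s 0

/-- In the first `L` layers, the rows of the weight matrices have `ℓ¹`-norm at most `ρ` and the
biases are at most `τ`. -/
def HasRowBound {W : ℕ → ℕ} (θ : NetParams W) (L : ℕ) (ρ τ : ℝ) : Prop :=
  ∀ l < L, ∀ k, ∑ j, |θ.1 l k j| ≤ ρ ∧ |θ.2 l k| ≤ τ

/-- The iterates of `s ↦ ρ * s + τ`. -/
def affineIter (ρ τ s : ℝ) : ℕ → ℝ
  | 0 => s
  | l + 1 => ρ * affineIter ρ τ s l + τ

lemma affineIter_eq (ρ τ s : ℝ) (l : ℕ) :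
    affineIter ρ τ s l = ρ ^ l * s + affineIter ρ τ 0 l := by
  induction l with
  | zero => simp [affineIter]
  | succ l ih => rw [affineIter, ih, affineIter, pow_succ]; ring

lemma affineIter_nonneg {ρ τ s : ℝ} (hρ : 0 ≤ ρ) (hτ : 0 ≤ τ) (hs : 0 ≤ s) (l : ℕ) :
    0 ≤ affineIter ρ τ s l := by
  induction l with
  | zero => exact hs
  | succ l ih => rw [affineIter]; positivity

lemma activation_lipschitz (l : ℕ) (s t : ℝ) : |activation l s - activation l t| ≤ |s - t| := by
  cases l with
  | zero => exact le_rfl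
  | succ l => exact abs_max_sub_max_le_abs s t 0

lemma activation_zero (l : ℕ) : activation l 0 = 0 := by cases l <;> simp [activation]

lemma abs_activation_le (l : ℕ) (s : ℝ) : |activation l s| ≤ |s| := by
  simpa [activation_zero] using activation_lipschitz l s 0

lemma continuous_activation (l : ℕ) : Continuous (activation l) := by
  cases l with
  | zero => exact continuous_id
  | succ l => exact continuous_id.max continuous_const

lemma neuron_succ {W : ℕ → ℕ} (θ : NetParams W) (l : ℕ) (k : Fin (W (l + 1)))
    (x : Fin (W 0) → ℝ) :
    neuron θ (l + 1) k x = ∑ j, θ.1 l k j * activation l (neuron θ l j x) + θ.2 l k := by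
  cases l <;> simp [neuron, reluNet, Matrix.mulVec, dotProduct, activation]

lemma continuous_neuron {W : ℕ → ℕ} (l : ℕ) (k : Fin (W l)) :
    Continuous fun p : NetParams W × (Fin (W 0) → ℝ) => neuron p.1 l k p.2 := by
  induction l with
  | zero =>
    have : (fun p : NetParams W × (Fin (W 0) → ℝ) => neuron p.1 0 k p.2) = fun p => p.2 k := rfl
    rw [this]
    fun_prop
  | succ l ih =>
    simp only [neuron_succ]
    refine Continuous.add (continuous_finsetSum _ fun j _ => Continuous.mul ?_ ?_) ?_
    · exact (continuous_apply_apply k j).comp ((continuous_apply l).comp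
        (continuous_fst.comp continuous_fst))
    · exact (continuous_activation l).comp (ih j)
    · exact (continuous_apply k).comp ((continuous_apply l).comp
        (continuous_snd.comp continuous_fst))

lemma abs_neuron_le {W : ℕ → ℕ} {θ : NetParams W} {L : ℕ} {ρ τ : ℝ} (hρ : 0 ≤ ρ)
    (hθ : HasRowBound θ L ρ τ) (x : Fin (W 0) → ℝ) {l : ℕ} (hl : l ≤ L) (k : Fin (W l)) :
    |neuron θ l k x| ≤ affineIter ρ τ (∑ j, |x j|) l := by
  induction l with
  | zero =>
    exact Finset.single_le_sum (f := fun j => |x j|) (fun _ _ => abs_nonneg _) (Finset.mem_univ k)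
  | succ l ih =>
    obtain ⟨h1, h2⟩ := hθ l (by omega) k
    rw [neuron_succ, affineIter]
    refine (abs_add_le _ _).trans (add_le_add ?_ h2)
    -- The sign of `τ` is not assumed. A neuron in the layer yields nonnegativity of the iterate;
    -- for an empty layer it comes from the bias bound at `k`.
    by_cases hW : Nonempty (Fin (W l))
    · obtain ⟨j₀⟩ := hW
      have h0 := (abs_nonneg _).trans (ih (by omega) j₀)
      calc |∑ j, θ.1 l k j * activation l (neuron θ l j x)|
          ≤ ∑ j, |θ.1 l k j| * affineIter ρ τ (∑ j, |x j|) l := by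
            refine (Finset.abs_sum_le_sum_abs _ _).trans (Finset.sum_le_sum fun j _ => ?_)
            rw [abs_mul]
            exact mul_le_mul_of_nonneg_left ((abs_activation_le _ _).trans (ih (by omega) j))
              (abs_nonneg _)
        _ ≤ ρ * affineIter ρ τ (∑ j, |x j|) l := by
          rw [← Finset.sum_mul]
          exact mul_le_mul_of_nonneg_right h1 h0
    · rw [not_nonempty_iff] at hW
      simp only [Finset.univ_eq_empty, Finset.sum_empty, abs_zero]
      have hτ := (abs_nonneg _).trans h2
      cases l with
      | zero => exact mul_nonneg hρ (Finset.sum_nonneg fun _ _ => abs_nonneg _)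
      | succ l =>
        refine mul_nonneg hρ (affineIter_nonneg hρ hτ
          (Finset.sum_nonneg fun _ _ => abs_nonneg _) _)

section Rademacher

variable {E : Type*} {W : ℕ → ℕ} {D : Type*} {θ : D → NetParams W}
  {L : ℕ} {ρ τ : ℝ} {u : E → Fin (W 0) → ℝ}

/-- Peeling of one layer. The signed sum is linear in the incoming weights, so `ℓ¹`–`ℓ∞` duality
extracts `ρ` and leaves a supremum over the previous layer, whatever its width. Contraction removes
the activation at the cost of a factor 2. -/
lemma rademacherSum_neuron_succ_le (hθ : ∀ a, HasRowBound (θ a) L ρ τ) {l : ℕ}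
    (hl : l < L) {N : ℕ} (x : Fin N → E) :
    rademacherSum (fun (p : D × Fin (W (l + 1))) i => neuron (θ p.1) (l + 1) p.2 (u (x i))) ≤
      ENNReal.ofReal (2 * ρ) *
        rademacherSum (fun (p : D × Fin (W l)) i => neuron (θ p.1) l p.2 (u (x i))) +
      ENNReal.ofReal τ * ∑ ε : Fin N → ℤˣ, ‖signSum ε fun _ => 1‖ₑ := by
  have h1 : ∀ (p : D × Fin (W (l + 1))) (ε : Fin N → ℤˣ),
      signSum ε (fun i => neuron (θ p.1) (l + 1) p.2 (u (x i))) =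
      ∑ j, (θ p.1).1 l p.2 j *
        signSum ε (fun i => activation l (neuron (θ p.1) l j (u (x i)))) +
      (θ p.1).2 l p.2 * signSum ε (fun _ => 1) := fun p ε => by
    simp only [signSum, neuron_succ, mul_add, Finset.sum_add_distrib, Finset.mul_sum]
    rw [Finset.sum_comm]
    congr 1
    · exact Finset.sum_congr rfl fun j _ => Finset.sum_congr rfl fun i _ => by ring
    · exact Finset.sum_congr rfl fun i _ => by ring
  have h2 : ∀ ε : Fin N → ℤˣ,
      (⨆ p : D × Fin (W (l + 1)),
        ‖signSum ε (fun i => neuron (θ p.1) (l + 1) p.2 (u (x i)))‖ₑ) ≤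
      ENNReal.ofReal ρ * (⨆ p : D × Fin (W l),
        ‖signSum ε (fun i => activation l (neuron (θ p.1) l p.2 (u (x i))))‖ₑ) +
      ENNReal.ofReal τ * ‖signSum ε fun _ => 1‖ₑ := fun ε => by
    refine iSup_le fun p => ?_
    rw [h1]
    obtain ⟨hA, hb⟩ := hθ p.1 l hl p.2
    refine (enorm_add_le _ _).trans (add_le_add ?_ ?_)
    · refine (enorm_sum_le _ _).trans ?_
      simp only [enorm_mul]
      refine (Finset.sum_le_sum fun j _ => mul_le_mul_right (le_iSup (fun p : D × Fin (W l) =>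
        ‖signSum ε (fun i => activation l (neuron (θ p.1) l p.2 (u (x i))))‖ₑ) (p.1, j)) _).trans ?_
      rw [← Finset.sum_mul]
      gcongr
      simp only [Real.enorm_eq_ofReal_abs]
      rw [← ENNReal.ofReal_sum_of_nonneg fun _ _ => abs_nonneg _]
      exact ENNReal.ofReal_le_ofReal hA
    · rw [enorm_mul]
      gcongr
      rw [Real.enorm_eq_ofReal_abs]
      exact ENNReal.ofReal_le_ofReal hb
  calc _ ≤ ENNReal.ofReal ρ * rademacherSum (fun (p : D × Fin (W l)) i =>
          activation l (neuron (θ p.1) l p.2 (u (x i)))) +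
        ENNReal.ofReal τ * ∑ ε : Fin N → ℤˣ, ‖signSum ε fun _ => 1‖ₑ := by
        unfold rademacherSum
        refine (Finset.sum_le_sum fun ε _ => h2 ε).trans (le_of_eq ?_)
        rw [Finset.sum_add_distrib, Finset.mul_sum, Finset.mul_sum]
    _ ≤ _ := by
      rw [ENNReal.ofReal_mul zero_le_two, mul_comm (ENNReal.ofReal 2), mul_assoc,
        ENNReal.ofReal_ofNat]
      refine add_le_add_left (mul_le_mul_right ?_ _) _
      exact rademacherSum_comp_le (fun (p : D × Fin (W l)) i => neuron (θ p.1) l p.2 (u (x i)))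
        (activation_lipschitz l) (activation_zero l)

variable [MeasurableSpace E] {P : Measure E} [IsProbabilityMeasure P] {σ : ℝ}

lemma lintegral_sum_signSum_le {f : E → ℝ} (hf : MemLp f 2 P) (hσ : 0 < σ)
    (hfσ : ∫ e, f e ^ 2 ∂P ≤ σ ^ 2) {N : ℕ} (hN : 1 ≤ N) :
    ∫⁻ x, ∑ ε : Fin N → ℤˣ, ‖signSum ε fun i => f (x i)‖ₑ ∂(Measure.pi fun _ : Fin N => P) ≤
      2 ^ N * ENNReal.ofReal (Real.sqrt N * σ) := by
  have hN0 : (0 : ℝ) < N := by exact_mod_cast hN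
  have hc : 0 < Real.sqrt N * σ := by positivity
  have h2N : (2 : ENNReal) ^ N ≠ ⊤ := ENNReal.pow_ne_top ENNReal.ofNat_ne_top
  have h : ∀ x : Fin N → E, ∑ ε : Fin N → ℤˣ, ‖signSum ε fun i => f (x i)‖ₑ ≤
      2 ^ N * ENNReal.ofReal (((∑ i, f (x i) ^ 2) / (Real.sqrt N * σ) + Real.sqrt N * σ) / 2) :=
    fun x => sum_enorm_signSum_le (fun i => f (x i)) hc
  refine (lintegral_mono h).trans ?_
  rw [lintegral_const_mul' _ _ h2N]
  refine mul_le_mul_right ?_ _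
  have hi : ∀ i : Fin N, Integrable (fun x : Fin N → E => f (x i) ^ 2)
      (Measure.pi fun _ : Fin N => P) := fun i =>
    integrable_comp_eval (μ := fun _ : Fin N => P) (i := i) hf.integrable_sq
  have hs := integrable_finsetSum Finset.univ fun i _ => hi i
  have hint : Integrable (fun x : Fin N → E => ((∑ i, f (x i) ^ 2) / (Real.sqrt N * σ) +
      Real.sqrt N * σ) / 2) (Measure.pi fun _ : Fin N => P) :=
    ((hs.div_const _).add (integrable_const _)).div_const 2
  rw [← ofReal_integral_eq_lintegral_ofReal hint (.of_forall fun x => by positivity)]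
  refine ENNReal.ofReal_le_ofReal ?_
  rw [integral_div, integral_add (hs.div_const _) (integrable_const _), integral_div,
    integral_const, probReal_univ, one_smul, integral_finsetSum _ fun i _ => hi i]
  have : ∀ i : Fin N, ∫ x : Fin N → E, f (x i) ^ 2 ∂(Measure.pi fun _ : Fin N => P) =
      ∫ e, f e ^ 2 ∂P := fun i =>
    integral_comp_eval (μ := fun _ : Fin N => P) (i := i) (f := fun e => f e ^ 2)
      hf.integrable_sq.aestronglyMeasurable
  simp only [this, Finset.sum_const, Finset.card_univ, Fintype.card_fin, nsmul_eq_mul]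
  rw [div_add' _ _ _ hc.ne', div_div, div_le_iff₀ (by positivity)]
  have h1 : (Real.sqrt N * σ) * (Real.sqrt N * σ) = N * σ ^ 2 := by
    rw [mul_mul_mul_comm, Real.mul_self_sqrt hN0.le, sq]
  nlinarith [mul_le_mul_of_nonneg_left hfσ hN0.le]

lemma lintegral_rademacherSum_neuron_le (hu : ∀ j, MemLp (fun e => u e j) 2 P) (hσ : 0 < σ)
    (huσ : ∀ j, ∫ e, u e j ^ 2 ∂P ≤ σ ^ 2) (hρ : 0 ≤ ρ) (hτ : 0 ≤ τ)
    (hθ : ∀ a, HasRowBound (θ a) L ρ τ) (hW : 1 ≤ W 0) {N : ℕ} (hN : 1 ≤ N) {l : ℕ} (hl : l ≤ L) :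
    ∫⁻ x, rademacherSum (fun (p : D × Fin (W l)) i => neuron (θ p.1) l p.2 (u (x i)))
        ∂(Measure.pi fun _ : Fin N => P) ≤
      2 ^ N * ENNReal.ofReal (W 0 * Real.sqrt N * affineIter (2 * ρ) τ σ l) := by
  have hW1 : (1 : ℝ) ≤ W 0 := by exact_mod_cast hW
  induction l with
  | zero =>
    -- On the input layer the supremum over coordinates is replaced by their sum; this is the origin
    -- of the factor `W 0`.
    have h1 : ∀ x : Fin N → E,
        rademacherSum (fun (p : D × Fin (W 0)) i => neuron (θ p.1) 0 p.2 (u (x i))) ≤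
        ∑ j, ∑ ε : Fin N → ℤˣ, ‖signSum ε fun i => u (x i) j‖ₑ := fun x => by
      rw [Finset.sum_comm]
      refine Finset.sum_le_sum fun ε _ => iSup_le fun p => ?_
      exact Finset.single_le_sum (f := fun j => ‖signSum ε fun i => u (x i) j‖ₑ)
        (fun _ _ => zero_le) (Finset.mem_univ p.2)
    refine (lintegral_mono h1).trans ?_
    rw [lintegral_finsetSum']
    · refine (Finset.sum_le_sum fun j _ =>
        lintegral_sum_signSum_le (hu j) hσ (huσ j) hN).trans (le_of_eq ?_)
      simp only [Finset.sum_const, Finset.card_univ, Fintype.card_fin, nsmul_eq_mul, affineIter]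
      rw [mul_left_comm, ← ENNReal.ofReal_natCast, ← ENNReal.ofReal_mul (by positivity), mul_assoc]
    · intro j _
      refine Finset.aemeasurable_fun_sum _ fun ε _ => AEMeasurable.enorm ?_
      unfold signSum
      refine Finset.aemeasurable_fun_sum _ fun i _ => AEMeasurable.const_mul ?_ _
      exact ((hu j).comp_measurePreserving
        (measurePreserving_eval (fun _ : Fin N => P) i)).aestronglyMeasurable.aemeasurable
  | succ l ih =>
    refine (lintegral_mono fun x => rademacherSum_neuron_succ_le hθ (by omega) x).trans ?_
    rw [lintegral_add_right _ measurable_const, lintegral_const_mul' _ _ ENNReal.ofReal_ne_top,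
      lintegral_const, measure_univ, mul_one]
    have h2 : ∑ ε : Fin N → ℤˣ, ‖signSum ε fun _ => 1‖ₑ ≤
        2 ^ N * ENNReal.ofReal (W 0 * Real.sqrt N) := by
      have hN0 : (0 : ℝ) < N := by exact_mod_cast hN
      refine (sum_enorm_signSum_le (fun _ : Fin N => (1 : ℝ)) (Real.sqrt_pos.2 hN0)).trans ?_
      gcongr
      simp only [one_pow, Finset.sum_const, Finset.card_univ, Fintype.card_fin, nsmul_eq_mul,
        mul_one, Real.div_sqrt, add_self_div_two]
      nlinarith [Real.sqrt_nonneg N]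
    calc _ ≤ ENNReal.ofReal (2 * ρ) * (2 ^ N * ENNReal.ofReal
            (W 0 * Real.sqrt N * affineIter (2 * ρ) τ σ l)) +
          ENNReal.ofReal τ * (2 ^ N * ENNReal.ofReal (W 0 * Real.sqrt N)) := by
          gcongr
          exact ih (by omega)
      _ = _ := by
        have := affineIter_nonneg (by positivity : 0 ≤ 2 * ρ) hτ hσ.le l
        rw [mul_left_comm, mul_left_comm (ENNReal.ofReal τ), ← mul_add,
          ← ENNReal.ofReal_mul (by positivity), ← ENNReal.ofReal_mul hτ,
          ← ENNReal.ofReal_add (by positivity) (by positivity), affineIter]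
        congr 2
        ring

lemma integrable_neuron (hum : Measurable u) (hu : ∀ j, MemLp (fun e => u e j) 2 P)
    (hρ : 0 ≤ ρ) {θ : NetParams W} (hθ : HasRowBound θ L ρ τ) {l : ℕ} (hl : l ≤ L)
    (k : Fin (W l)) : Integrable (fun e => neuron θ l k (u e)) P := by
  have h1 : Integrable (fun e => affineIter ρ τ (∑ j, |u e j|) l) P := by
    simp only [affineIter_eq _ _ (∑ j, |u _ j|)]
    exact ((integrable_finsetSum _ fun j _ =>
      ((hu j).integrable one_le_two).abs).const_mul _).add (integrable_const _)
  refine h1.mono' ?_ (.of_forall fun e => abs_neuron_le hρ hθ (u e) hl k)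
  exact (((continuous_neuron l k).comp (Continuous.prodMk_right θ)).measurable.comp
    hum).aestronglyMeasurable

lemma integral_abs_le_of_integral_sq_le {f : E → ℝ} (hf : MemLp f 2 P) (hσ : 0 < σ)
    (hfσ : ∫ e, f e ^ 2 ∂P ≤ σ ^ 2) : ∫ e, |f e| ∂P ≤ σ := by
  have h := lintegral_enorm_le_of_integral_sq_le hσ hf.integrable_sq hfσ
  simp only [Real.enorm_eq_ofReal_abs] at h
  rwa [← ofReal_integral_eq_lintegral_ofReal (hf.integrable one_le_two).abs
    (.of_forall fun _ => abs_nonneg _), ENNReal.ofReal_le_ofReal_iff hσ.le] at h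

/-- An a priori bound on the mean output, used where the total importance weight is too small for
the sampling argument. -/
lemma abs_integral_neuron_le (hum : Measurable u) (hu : ∀ j, MemLp (fun e => u e j) 2 P)
    (hσ : 0 < σ) (huσ : ∀ j, ∫ e, u e j ^ 2 ∂P ≤ σ ^ 2) (hρ : 0 ≤ ρ) (hτ : 0 ≤ τ)
    (hW : 1 ≤ W 0) {θ : NetParams W} (hθ : HasRowBound θ L ρ τ) {l : ℕ} (hl : l ≤ L)
    (k : Fin (W l)) :
    |∫ e, neuron θ l k (u e) ∂P| ≤ W 0 * affineIter ρ τ σ l := by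
  have hW1 : (1 : ℝ) ≤ W 0 := by exact_mod_cast hW
  have h1 : Integrable (fun e => ∑ j, |u e j|) P :=
    integrable_finsetSum _ fun j _ => ((hu j).integrable one_le_two).abs
  calc |∫ e, neuron θ l k (u e) ∂P| ≤ ∫ e, |neuron θ l k (u e)| ∂P := abs_integral_le_integral_abs
    _ ≤ ∫ e, (ρ ^ l * (∑ j, |u e j|) + affineIter ρ τ 0 l) ∂P := by
      refine integral_mono (integrable_neuron hum hu hρ hθ hl k).abs
        ((h1.const_mul _).add (integrable_const _)) fun e => ?_
      simp only [← affineIter_eq]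
      exact abs_neuron_le hρ hθ (u e) hl k
    _ = ρ ^ l * ∑ j, ∫ e, |u e j| ∂P + affineIter ρ τ 0 l := by
      rw [integral_add (h1.const_mul _) (integrable_const _), integral_const_mul,
        integral_finsetSum _ fun j _ => ((hu j).integrable one_le_two).abs]
      simp
    _ ≤ ρ ^ l * (W 0 * σ) + affineIter ρ τ 0 l := by
      gcongr
      refine (Finset.sum_le_sum fun j _ =>
        integral_abs_le_of_integral_sq_le (hu j) hσ (huσ j)).trans (by simp)
    _ ≤ W 0 * affineIter ρ τ σ l := by
      rw [affineIter_eq ρ τ σ, mul_add]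
      have := affineIter_nonneg hρ hτ le_rfl l
      nlinarith [mul_le_mul_of_nonneg_right hW1 this]

/-- **Uniform law of large numbers for ReLU networks**: over all networks with bounded rows, the
deviation of the empirical mean is dominated by a measurable function with mean `O(1 / √N)`. -/
theorem exists_measurable_bound_neuron (hum : Measurable u)
    (hu : ∀ j, MemLp (fun e => u e j) 2 P) (hσ : 0 < σ)
    (huσ : ∀ j, ∫ e, u e j ^ 2 ∂P ≤ σ ^ 2) (hρ : 0 ≤ ρ) (hτ : 0 ≤ τ)
    (hW : 1 ≤ W 0) {N : ℕ} (hN : 1 ≤ N) :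
    ∃ F : (Fin N → E) → ENNReal, Measurable F ∧
      ∫⁻ x, F x ∂(Measure.pi fun _ : Fin N => P) ≤
        ENNReal.ofReal (2 * (W 0 * Real.sqrt N * affineIter (2 * ρ) τ σ L)) ∧
      ∀ θ : NetParams W, HasRowBound θ L ρ τ → ∀ (k : Fin (W L)) (x : Fin N → E),
        ‖∑ i, (neuron θ L k (u (x i)) - ∫ e, neuron θ L k (u e) ∂P)‖ₑ ≤ F x := by
  let Θ : Set (NetParams W) := {θ | HasRowBound θ L ρ τ}
  -- The majorant is a supremum over countably many networks, hence measurable; continuity in the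
  -- parameters extends it to all networks, for every sample.
  obtain ⟨s, hs, hsd⟩ := TopologicalSpace.exists_countable_dense Θ
  have : Countable s := hs
  let g : s × Fin (W L) → E → ℝ := fun p e => neuron p.1.1.1 L p.2 (u e)
  have hcont : ∀ (θ : NetParams W) k, Measurable fun e => neuron θ L k (u e) := fun θ k =>
    ((continuous_neuron L k).comp (Continuous.prodMk_right θ)).measurable.comp hum
  have hg : ∀ p, Measurable (g p) := fun p => hcont _ _
  have hgi : ∀ p, Integrable (g p) P := fun p => integrable_neuron hum hu hρ p.1.1.2 le_rfl p.2
  refine ⟨fun x => ⨆ p, ‖∑ i, (g p (x i) - ∫ e, g p e ∂P)‖ₑ, ?_, ?_, ?_⟩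
  · refine Measurable.iSup fun p => Measurable.enorm ?_
    have := hg p
    fun_prop
  · have h1 := lintegral_iSup_enorm_sum_sub_integral_le P g hg hgi N
    have h2 := lintegral_rademacherSum_neuron_le (D := s) (θ := fun a => a.1.1) hu hσ huσ hρ hτ
      (fun a => a.1.2) hW hN le_rfl
    have h3 := h1.trans (mul_le_mul_right h2 2)
    rw [mul_left_comm] at h3
    rw [ENNReal.ofReal_mul zero_le_two, ENNReal.ofReal_ofNat]
    exact (ENNReal.mul_le_mul_iff_right (by simp) (by simp)).1 h3
  · intro θ hθ k x
    have hc : Continuous fun θ : Θ =>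
        ‖∑ i, (neuron θ.1 L k (u (x i)) - ∫ e, neuron θ.1 L k (u e) ∂P)‖ₑ := by
      have hci : Continuous fun θ : Θ => ∫ e, neuron θ.1 L k (u e) ∂P := by
        refine continuous_of_dominated (bound := fun e => affineIter ρ τ (∑ j, |u e j|) L)
          (fun θ => (hcont _ _).aestronglyMeasurable)
          (fun θ => .of_forall fun e => abs_neuron_le hρ θ.2 (u e) le_rfl k) ?_
          (.of_forall fun e => ?_)
        · simp only [affineIter_eq _ _ (∑ j, |u _ j|)]
          exact ((integrable_finsetSum _ fun j _ =>
            ((hu j).integrable one_le_two).abs).const_mul _).add (integrable_const _)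
        · exact (continuous_neuron L k).comp (continuous_subtype_val.prodMk continuous_const)
      refine continuous_enorm.comp (continuous_finsetSum _ fun i _ => Continuous.sub ?_ hci)
      exact (continuous_neuron L k).comp (continuous_subtype_val.prodMk continuous_const)
    have hclosed := isClosed_le hc (continuous_const (y := ⨆ p,
      ‖∑ i, (g p (x i) - ∫ e, g p e ∂P)‖ₑ))
    have := hclosed.closure_subset_iff.2 fun a (ha : a ∈ s) =>
      le_iSup (fun p => ‖∑ i, (g p (x i) - ∫ e, g p e ∂P)‖ₑ) (⟨a, ha⟩, k)
    exact this (hsd ⟨θ, hθ⟩)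

end Rademacher


/-! ### Moments of sub-Gaussian laws and of posteriors -/

/-- Since `1 + s ≤ exp s`, the bound 2 on the exponential moment along a coordinate vector leaves at
most 1 for the mean of `x k ^ 2 / σ ^ 2`. -/
lemma memLp_coord_of_isSubGaussian {n : ℕ} {P : Measure (Euc n)} [IsProbabilityMeasure P] {σ : ℝ}
    (h : IsSubGaussian P σ) (k : Fin n) :
    MemLp (fun x : Euc n => x k) 2 P ∧ ∫ x : Euc n, x k ^ 2 ∂P ≤ σ ^ 2 := by
  obtain ⟨hσ, h⟩ := h
  have h1 := h (EuclideanSpace.single k 1) (by simp)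
  have h2 : ∀ x : Euc n, 1 + ENNReal.ofReal (x k ^ 2 / σ ^ 2) ≤
      ENNReal.ofReal (Real.exp (inner ℝ (EuclideanSpace.single k (1 : ℝ)) x ^ 2 / σ ^ 2)) :=
    fun x => by
    rw [← ENNReal.ofReal_one, ← ENNReal.ofReal_add zero_le_one (by positivity)]
    refine ENNReal.ofReal_le_ofReal ?_
    rw [EuclideanSpace.inner_single_left]
    simp only [map_one, one_mul]
    linarith [Real.add_one_le_exp (x k ^ 2 / σ ^ 2)]
  have hm : Measurable fun x : Euc n => x k := by fun_prop
  have h3 := (lintegral_mono h2).trans h1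
  rw [lintegral_add_left measurable_const, lintegral_const, measure_univ, mul_one] at h3
  have h4 : ∫⁻ x : Euc n, ENNReal.ofReal (x k ^ 2 / σ ^ 2) ∂P ≤ 1 := by
    have h5 : (2 : ENNReal) = 1 + 1 := by norm_num
    exact (ENNReal.add_le_add_iff_left ENNReal.one_ne_top).1 (h3.trans h5.le)
  have hi : Integrable (fun x : Euc n => x k ^ 2 / σ ^ 2) P := by
    refine ⟨by fun_prop, ?_⟩
    rw [hasFiniteIntegral_iff_ofReal (.of_forall fun x => by positivity)]
    exact h4.trans_lt ENNReal.one_lt_top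
  have hi2 : Integrable (fun x : Euc n => x k ^ 2) P := by
    have := hi.mul_const (σ ^ 2)
    simpa [div_mul_cancel₀ _ (pow_pos hσ 2).ne'] using this
  refine ⟨(memLp_two_iff_integrable_sq hm.aestronglyMeasurable).2 hi2, ?_⟩
  rw [← ofReal_integral_eq_lintegral_ofReal hi (.of_forall fun x => by positivity),
    ENNReal.ofReal_le_one, integral_div, div_le_one (by positivity)] at h4
  exact h4

lemma integrable_of_coord {n : ℕ} {α : Type*} [MeasurableSpace α] {μ : Measure α}
    {f : α → Euc n} (h : ∀ k, Integrable (fun x => f x k) μ) : Integrable f μ := by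
  have : Integrable (fun x => ∑ k, (f x k) • EuclideanSpace.single k (1 : ℝ)) μ :=
    integrable_finsetSum _ fun k _ => (h k).smul_const _
  refine this.congr (.of_forall fun x => ?_)
  ext j
  simp [Finset.sum_apply, Pi.single_apply]

lemma integral_coord {n : ℕ} {α : Type*} [MeasurableSpace α] {μ : Measure α}
    {f : α → Euc n} (h : ∀ k, Integrable (fun x => f x k) μ) (k : Fin n) :
    (∫ x, f x ∂μ) k = ∫ x, f x k ∂μ :=
  ((EuclideanSpace.proj (𝕜 := ℝ) k).integral_comp_comm (integrable_of_coord h)).symm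

lemma norm_le_sum_abs {n : ℕ} (v : Euc n) : ‖v‖ ≤ ∑ k, |v k| := by
  rw [EuclideanSpace.norm_eq]
  refine Real.sqrt_le_iff.2 ⟨Finset.sum_nonneg fun _ _ => abs_nonneg _, ?_⟩
  exact Finset.sum_sq_le_sq_sum_of_nonneg fun k _ => norm_nonneg (v k)

/-- Normalization cancels the constant `a`, so the weight can stand for the likelihood. -/
lemma integral_bayesUpdate_coord {n : ℕ} {P : Measure (Euc n)} {ℓ w : Euc n → ℝ} {a : ℝ}
    (ha : 0 < a) (hw : ∀ x, w x = a * ℓ x) (hℓ : Measurable ℓ) (h0 : ∀ x, 0 ≤ ℓ x)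
    (hwi : Integrable w P) (hi : ∀ k, Integrable (fun x : Euc n => w x * x k) P) (k : Fin n) :
    (∫ z, z ∂bayesUpdate ℓ P) k = (∫ x, w x ∂P)⁻¹ * ∫ x, w x * x k ∂P := by
  have hℓw : ∀ x, ℓ x = a⁻¹ * w x := fun x => by rw [hw]; field_simp
  have hℓi : Integrable ℓ P := by
    simp only [funext hℓw]
    exact hwi.const_mul _
  have hik : ∀ k, Integrable (fun x : Euc n => (ℓ x • x) k) P := fun k => by
    simp only [PiLp.smul_apply, smul_eq_mul, hℓw, mul_assoc]
    exact (hi k).const_mul _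
  unfold bayesUpdate
  rw [integral_smul_measure, integral_withDensity_eq_integral_toReal_smul (by fun_prop)
    (.of_forall fun x => ENNReal.ofReal_lt_top)]
  simp only [ENNReal.toReal_ofReal (h0 _)]
  rw [PiLp.smul_apply, integral_coord hik, ENNReal.toReal_inv,
    ← ofReal_integral_eq_lintegral_ofReal hℓi (.of_forall h0),
    ENNReal.toReal_ofReal (integral_nonneg h0)]
  simp only [PiLp.smul_apply, smul_eq_mul, hℓw, mul_assoc, integral_const_mul]
  field_simp

section Weights

variable {n : ℕ} {P : Measure (Euc n)} [IsProbabilityMeasure P] {w : Euc n → ℝ} {B κ σ : ℝ}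

/-- Both `w` and its mean lie in `[0, B]`, so each centered summand is bounded by `B`. -/
lemma lintegral_enorm_sum_weight_sub_le (hw : Measurable w) (h0 : ∀ x, 0 ≤ w x)
    (hB : ∀ x, w x ≤ B) (hBpos : 0 < B) {N : ℕ} (hN : 1 ≤ N) :
    ∫⁻ x, ‖∑ i, (w (x i) - ∫ z, w z ∂P)‖ₑ ∂(Measure.pi fun _ : Fin N => P) ≤
      ENNReal.ofReal (Real.sqrt N * B) := by
  have hwi : Integrable w P := Integrable.of_bound hw.aestronglyMeasurable B
    (.of_forall fun x => by rw [Real.norm_of_nonneg (h0 x)]; exact hB x)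
  have hZ0 : 0 ≤ ∫ z, w z ∂P := integral_nonneg h0
  have hZB : ∫ z, w z ∂P ≤ B := by
    simpa using integral_mono hwi (integrable_const B) hB
  have hb : ∀ x, ‖w x - ∫ z, w z ∂P‖ ≤ B := fun x =>
    abs_le.2 ⟨by linarith [h0 x], by linarith [hB x]⟩
  have hLp : MemLp (fun x => w x - ∫ z, w z ∂P) 2 P :=
    MemLp.of_bound (by fun_prop) B (.of_forall hb)
  refine lintegral_enorm_sum_le P hLp ?_ hBpos ?_ hN
  · rw [integral_sub hwi (integrable_const _)]; simp
  · have := integral_mono hLp.integrable_sq (integrable_const (B ^ 2)) fun x =>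
      sq_le_sq' (abs_le.1 (hb x)).1 (abs_le.1 (hb x)).2
    simpa using this

omit [IsProbabilityMeasure P] in
lemma memLp_weight_mul (hw : Measurable w) (h0 : ∀ x, 0 ≤ w x) (hB : ∀ x, w x ≤ B)
    {f : Euc n → ℝ} (hf : MemLp f 2 P) : MemLp (fun x => w x * f x) 2 P := by
  refine hf.of_le_mul (c := B) (hw.aestronglyMeasurable.mul hf.aestronglyMeasurable)
    (.of_forall fun x => ?_)
  rw [norm_mul, Real.norm_of_nonneg (h0 x)]
  exact mul_le_mul_of_nonneg_right (hB x) (norm_nonneg _)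

lemma abs_weighted_mean_le (hw : Measurable w) (h0 : ∀ x, 0 ≤ w x)
    (hB : ∀ x, w x ≤ B) (hBpos : 0 < B) (hκ : 0 < κ) (hκw : κ ≤ ∫ x, w x ∂P) (hσ : 0 < σ)
    {f : Euc n → ℝ} (hf : MemLp f 2 P) (hfσ : ∫ x, f x ^ 2 ∂P ≤ σ ^ 2) :
    |(∫ x, w x ∂P)⁻¹ * ∫ x, w x * f x ∂P| ≤ B * σ / κ := by
  have hZ : 0 < ∫ x, w x ∂P := hκ.trans_le hκw
  rw [abs_mul, abs_inv, abs_of_pos hZ, inv_mul_eq_div]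
  have h1 : |∫ x, w x * f x ∂P| ≤ B * σ := by
    calc |∫ x, w x * f x ∂P| ≤ ∫ x, |w x * f x| ∂P := abs_integral_le_integral_abs
      _ ≤ ∫ x, B * |f x| ∂P := by
        refine integral_mono ((memLp_weight_mul hw h0 hB hf).integrable one_le_two).abs
          ((hf.integrable one_le_two).abs.const_mul B) fun x => ?_
        simp only [abs_mul, abs_of_nonneg (h0 x)]
        exact mul_le_mul_of_nonneg_right (hB x) (abs_nonneg _)
      _ ≤ B * σ := by
        rw [integral_const_mul]
        exact mul_le_mul_of_nonneg_left (integral_abs_le_of_integral_sq_le hf hσ hfσ) hBpos.le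
  exact div_le_div₀ (by positivity) h1 hκ hκw

/-- As `m` is the weighted mean of `f`, the summands `w * (f - m)` are centered, without bias from
self-normalization. Their second moment is controlled by `(f - m)² ≤ 2f² + 2m²` and `|m| ≤ Bσ/κ`. -/
lemma lintegral_enorm_sum_weight_mul_sub_le (hw : Measurable w) (h0 : ∀ x, 0 ≤ w x)
    (hB : ∀ x, w x ≤ B) (hBpos : 0 < B) (hκ : 0 < κ) (hκw : κ ≤ ∫ x, w x ∂P) (hσ : 0 < σ)
    {f : Euc n → ℝ} (hf : MemLp f 2 P) (hfσ : ∫ x, f x ^ 2 ∂P ≤ σ ^ 2) {m : ℝ}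
    (hm : m = (∫ x, w x ∂P)⁻¹ * ∫ x, w x * f x ∂P) {N : ℕ} (hN : 1 ≤ N) :
    ∫⁻ x, ‖∑ i, w (x i) * (f (x i) - m)‖ₑ ∂(Measure.pi fun _ : Fin N => P) ≤
      ENNReal.ofReal (Real.sqrt N * (2 * B * (σ + B * σ / κ))) := by
  have hZ : 0 < ∫ x, w x ∂P := hκ.trans_le hκw
  have hwi : Integrable w P := Integrable.of_bound hw.aestronglyMeasurable B
    (.of_forall fun x => by rw [Real.norm_of_nonneg (h0 x)]; exact hB x)
  have hfm : MemLp (fun x => f x - m) 2 P := hf.sub (memLp_const m)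
  have hLp := memLp_weight_mul hw h0 hB hfm
  have hmb := abs_weighted_mean_le hw h0 hB hBpos hκ hκw hσ hf hfσ
  rw [← hm] at hmb
  refine lintegral_enorm_sum_le P hLp ?_ (by positivity) ?_ hN
  · simp only [mul_sub]
    rw [integral_sub ((memLp_weight_mul hw h0 hB hf).integrable one_le_two)
      (hwi.mul_const m), integral_mul_const, hm]
    field_simp
    ring
  · have hm2 : m ^ 2 ≤ (B * σ / κ) ^ 2 := by
      rw [← sq_abs m]
      gcongr
    have hμ : 0 ≤ B * σ / κ := by positivity
    calc ∫ x, (w x * (f x - m)) ^ 2 ∂P ≤ ∫ x, B ^ 2 * (2 * f x ^ 2 + 2 * m ^ 2) ∂P := by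
          refine integral_mono hLp.integrable_sq
            (((hf.integrable_sq.const_mul 2).add (integrable_const _)).const_mul _) fun x => ?_
          simp only [mul_pow]
          refine mul_le_mul (pow_le_pow_left₀ (h0 x) (hB x) 2) ?_ (sq_nonneg _) (sq_nonneg _)
          nlinarith [sq_nonneg (f x + m)]
      _ = B ^ 2 * (2 * ∫ x, f x ^ 2 ∂P + 2 * m ^ 2) := by
        rw [integral_const_mul, integral_add (hf.integrable_sq.const_mul 2) (integrable_const _),
          integral_const_mul]
        simp
      _ ≤ B ^ 2 * (2 * σ ^ 2 + 2 * (B * σ / κ) ^ 2) := by gcongr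
      _ ≤ B ^ 2 * (4 * (σ + B * σ / κ) ^ 2) := by
        gcongr
        nlinarith [mul_nonneg hσ.le hμ, sq_nonneg σ, sq_nonneg (B * σ / κ)]
      _ = (2 * B * (σ + B * σ / κ)) ^ 2 := by ring

end Weights


/-! ### The maximum mean discrepancy of the linear kernel -/

section LinearKernel

variable {n : ℕ} {𝓗 : Type*} [NormedAddCommGroup 𝓗] [InnerProductSpace ℝ 𝓗] [CompleteSpace 𝓗]
  [RKHS ℝ 𝓗 (Euc n) ℝ] {c : ℝ}

variable (𝓗) in
/-- The element of the reproducing kernel Hilbert space that represents `h ↦ h z - h 0`. -/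
def centeredKernel (z : Euc n) : 𝓗 := RKHS.kerFun 𝓗 z 1 - RKHS.kerFun 𝓗 0 1

lemma inner_centeredKernel (z : Euc n) (h : 𝓗) : inner ℝ (centeredKernel 𝓗 z) h = h z - h 0 := by
  simp [centeredKernel, inner_sub_left]

/-- Subtracting the kernel section at 0 cancels `c`; what remains embeds `ℝⁿ` linearly and
isometrically into `𝓗`. -/
lemma centeredKernel_apply (hK : HasLinearKernel 𝓗 c) (z x : Euc n) :
    centeredKernel 𝓗 z x = inner ℝ x z := by
  simp [centeredKernel, RKHS.kerFun_apply, hK _ _]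

lemma norm_centeredKernel (hK : HasLinearKernel 𝓗 c) (z : Euc n) : ‖centeredKernel 𝓗 z‖ = ‖z‖ := by
  have h : ‖centeredKernel 𝓗 z‖ ^ 2 = ‖z‖ ^ 2 := by
    rw [← real_inner_self_eq_norm_sq, inner_centeredKernel, centeredKernel_apply hK,
      centeredKernel_apply hK, real_inner_self_eq_norm_sq]
    simp
  exact (sq_eq_sq₀ (norm_nonneg _) (norm_nonneg _)).1 h

lemma isLinearMap_centeredKernel (hK : HasLinearKernel 𝓗 c) :
    IsLinearMap ℝ (centeredKernel 𝓗 : Euc n → 𝓗) where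
  map_add z z' := RKHS.ext fun x => by
    simp [centeredKernel_apply hK, inner_add_right]
  map_smul r z := RKHS.ext fun x => by
    simp [centeredKernel_apply hK, real_inner_smul_right]

/-- Because the weights sum to one, the values at 0 cancel and the difference is an inner product
with a single centered kernel section. -/
lemma abs_sub_le_of_mem_rkhsUnitBall (hK : HasLinearKernel 𝓗 c) {f : Euc n → ℝ}
    (hf : f ∈ rkhsUnitBall 𝓗) {ι : Type*} (s : Finset ι) (p : ι → ℝ) (hp : ∑ j ∈ s, p j = 1)
    (x : ι → Euc n) (m : Euc n) :
    |f m - ∑ j ∈ s, p j * f (x j)| ≤ ‖m - ∑ j ∈ s, p j • x j‖ := by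
  obtain ⟨h, hh, rfl⟩ := hf
  have e : h m - ∑ j ∈ s, p j * h (x j) =
      inner ℝ (centeredKernel 𝓗 (m - ∑ j ∈ s, p j • x j)) h := by
    have e1 : centeredKernel 𝓗 (m - ∑ j ∈ s, p j • x j) =
        centeredKernel 𝓗 m - ∑ j ∈ s, p j • centeredKernel 𝓗 (x j) := by
      have hlin : IsLinearMap ℝ (centeredKernel 𝓗) := isLinearMap_centeredKernel hK
      have := map_sub (hlin.mk' _) m (∑ j ∈ s, p j • x j)
      simpa only [map_sum, map_smul, IsLinearMap.mk'_apply] using this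
    rw [e1, inner_sub_left, sum_inner, inner_centeredKernel]
    simp only [inner_smul_left, inner_centeredKernel, mul_sub, Finset.sum_sub_distrib,
      ← Finset.sum_mul]
    simp [hp]
  rw [e]
  refine (abs_real_inner_le_norm _ _).trans ?_
  rw [norm_centeredKernel hK]
  exact mul_le_of_le_one_right (norm_nonneg _) hh

/-- Testing against the centered kernel section in the direction of the difference of means bounds
the discrepancy of `G` from below; the preceding lemma bounds that of the constant competitor from
above. -/
lemma norm_sub_le_of_isEmpiricalMinimizer (hK : HasLinearKernel 𝓗 c) {N₁ N₂ : ℕ} (hN : 1 ≤ N₁)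
    {𝒢 : Set (Euc n → Euc n)} {w : Euc n → ℝ} {x : Fin N₁ → Euc n} {x' : Fin N₂ → Euc n}
    {G : Euc n → Euc n} (hG : IsEmpiricalMinimizer 𝒢 (rkhsUnitBall 𝓗) w x x' G) {m : Euc n}
    (hm : (fun _ => m) ∈ 𝒢) (hw : 0 < ∑ k, w (x' k)) :
    ‖(1 / (N₁ : ℝ)) • ∑ i, G (x i) - ∑ j, (w (x' j) / ∑ k, w (x' k)) • x' j‖ ≤
      ‖m - ∑ j, (w (x' j) / ∑ k, w (x' k)) • x' j‖ := by
  set s := ∑ j, (w (x' j) / ∑ k, w (x' k)) • x' j with hs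
  have hN0 : (N₁ : ℝ) ≠ 0 := by positivity
  have hp : ∑ j, w (x' j) / ∑ k, w (x' k) = 1 := by
    rw [← Finset.sum_div, div_self hw.ne']
  have h1 : empiricalMMD (rkhsUnitBall 𝓗) w x x' (fun _ => m) ≤ ENNReal.ofReal ‖m - s‖ := by
    refine iSup₂_le fun f hf => ENNReal.ofReal_le_ofReal ?_
    have := abs_sub_le_of_mem_rkhsUnitBall hK hf Finset.univ _ hp x' m
    simpa [snisMean, hN0] using this
  set d := (1 / (N₁ : ℝ)) • ∑ i, G (x i) - s with hd
  by_cases hd0 : d = 0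
  · rw [hd0, norm_zero]; exact norm_nonneg _
  have hdn : 0 < ‖d‖ := norm_pos_iff.2 hd0
  let h : 𝓗 := centeredKernel 𝓗 (‖d‖⁻¹ • d)
  have hh : ‖h‖ ≤ 1 := by
    rw [norm_centeredKernel hK, norm_smul, norm_inv, norm_norm, inv_mul_cancel₀ hdn.ne']
  have h2 : ENNReal.ofReal ‖d‖ ≤ empiricalMMD (rkhsUnitBall 𝓗) w x x' G := by
    refine le_trans (le_of_eq ?_) (le_iSup₂ (f := fun f _ => ENNReal.ofReal
      |1 / (N₁ : ℝ) * ∑ i, f (G (x i)) - snisMean w x' f|) (h : Euc n → ℝ) ⟨h, hh, rfl⟩)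
    congr 1
    have e : 1 / (N₁ : ℝ) * ∑ i, h (G (x i)) - snisMean w x' h = inner ℝ d (‖d‖⁻¹ • d) := by
      simp only [h, centeredKernel_apply hK, snisMean]
      generalize ‖d‖⁻¹ • d = v
      rw [hd, hs, inner_sub_left, real_inner_smul_left, sum_inner, sum_inner]
      simp only [real_inner_smul_left]
    rw [e, real_inner_smul_right, real_inner_self_eq_norm_sq, abs_of_nonneg (by positivity), sq,
      inv_mul_cancel_left₀ hdn.ne']
  exact (ENNReal.ofReal_le_ofReal_iff (norm_nonneg _)).1 (h2.trans ((hG.2 _ hm).trans h1))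

end LinearKernel


/-! ### The network class and the error bound -/

section NetworkClass

variable {n L S : ℕ} {W : ℕ → ℕ} {R : ℝ}

lemma const_mem_reluClass (hL : 1 ≤ L) (hin : W 0 = n) (hout : W L = n) {m : Euc n}
    (hR : 0 ≤ R) (hmR : ∀ i, |m i| ≤ R) (hmS : {i | m i ≠ 0}.ncard ≤ S) :
    (fun _ => m) ∈ reluClass n L W S R := by
  classical
  obtain ⟨L, rfl⟩ : ∃ l, L = l + 1 := ⟨L - 1, by omega⟩
  -- Layers are indexed from 0, so the last of `L + 1` layers has index `L`; its bias carries `m`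
  -- and is the only nonzero parameter.
  let b : ∀ l, Fin (W (l + 1)) → ℝ := fun l i =>
    if h : l = L then m (Fin.cast (h ▸ hout) i) else 0
  have hbL : ∀ i, b L i = m (Fin.cast hout i) := fun i => by simp [b]
  have hb : ∀ l, l ≠ L → ∀ i, b l i = 0 := fun l hl i => by simp [b, hl]
  refine ⟨fun _ => 0, b, hin, hout, ?_, fun l hl => ⟨fun i j => by simpa using hR, fun i => ?_⟩,
    fun x i => ?_⟩
  · simp only [Matrix.zero_apply, ne_eq, not_true_eq_false, Set.ofPred_false, Set.ncard_empty,
      zero_add]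
    rw [Finset.sum_eq_single L]
    · refine le_trans (le_of_eq ?_) hmS
      rw [← Set.ncard_image_of_injective _ (finCongr hout).injective]
      congr 1
      ext i
      simp only [Set.mem_image, Set.mem_ofPred_eq, hbL]
      exact ⟨fun ⟨j, hj, e⟩ => e ▸ hj, fun h => ⟨(finCongr hout).symm i, by simpa using h, by simp⟩⟩
    · intro l _ hl
      simp [hb l hl]
    · simp
  · by_cases h : l = L
    · subst h
      rw [hbL]
      exact hmR _
    · rw [hb l h]
      simpa using hR
  · cases L with
    | zero => simp [reluNet, hbL]
    | succ L => simp [reluNet, hbL]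

/-- Sparsity replaces all dependence on the widths: a row has at most `S` nonzero entries of size at
most `R`, and an output coordinate that is not identically zero uses up a nonzero parameter of the
last layer. -/
lemma exists_netParams_of_mem_reluClass (hL : 1 ≤ L) {G : Euc n → Euc n}
    (hG : G ∈ reluClass n L W S R) :
    ∃ (θ : NetParams W) (hin : W 0 = n) (hout : W L = n) (K : Finset (Fin n)),
      HasRowBound θ L (S * R) R ∧ K.card ≤ S ∧
      (∀ x i, G x i = neuron θ L (Fin.cast hout.symm i) fun j => x (Fin.cast hin j)) ∧
      ∀ i ∉ K, ∀ x, G x i = 0 := by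
  classical
  obtain ⟨A, b, hin, hout, hS, hR, hG⟩ := hG
  have hSl : ∀ l < L, {p : Fin (W (l + 1)) × Fin (W l) | A l p.1 p.2 ≠ 0}.ncard +
      {i | b l i ≠ 0}.ncard ≤ S := fun l hl =>
    (Finset.single_le_sum (f := fun l => {p : Fin (W (l + 1)) × Fin (W l) |
      A l p.1 p.2 ≠ 0}.ncard + {i | b l i ≠ 0}.ncard) (fun _ _ => Nat.zero_le _)
      (Finset.mem_range.2 hl)).trans hS
  refine ⟨(A, b), hin, hout, Finset.univ.filter fun i =>
    (∃ j, A (L - 1) (Fin.cast (by rw [Nat.sub_add_cancel hL, hout]) i) j ≠ 0) ∨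
      b (L - 1) (Fin.cast (by rw [Nat.sub_add_cancel hL, hout]) i) ≠ 0, ?_, ?_, hG, ?_⟩
  · intro l hl k
    refine ⟨?_, (hR l hl).2 k⟩
    by_cases hex : ∃ j, A l k j ≠ 0
    · have hR0 : 0 ≤ R := by
        obtain ⟨j, _⟩ := hex
        exact (abs_nonneg _).trans ((hR l hl).1 k j)
      have h1 : (Finset.univ.filter fun j => A l k j ≠ 0).card ≤ S := by
        refine le_trans ?_ ((Nat.le_add_right _ _).trans (hSl l hl))
        rw [← Set.ncard_coe_finset,
          ← Set.ncard_image_of_injective _ (Prod.mk_right_injective k)]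
        refine Set.ncard_le_ncard ?_ (Set.toFinite _)
        rintro _ ⟨j, hj, rfl⟩
        simpa using hj
      calc ∑ j, |A l k j| = ∑ j ∈ Finset.univ.filter fun j => A l k j ≠ 0, |A l k j| := by
            symm
            refine Finset.sum_subset (Finset.subset_univ _) fun j _ hj => ?_
            simpa using hj
        _ ≤ ∑ j ∈ Finset.univ.filter fun j => A l k j ≠ 0, R :=
          Finset.sum_le_sum fun j _ => (hR l hl).1 k j
        _ ≤ S * R := by
          rw [Finset.sum_const, nsmul_eq_mul]
          gcongr
    · push Not at hex
      simp only [hex, abs_zero, Finset.sum_const_zero]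
      exact mul_nonneg (Nat.cast_nonneg _) ((abs_nonneg _).trans ((hR l hl).2 k))
  · obtain ⟨l, rfl⟩ : ∃ l, L = l + 1 := ⟨L - 1, by omega⟩
    refine le_trans ?_ (hSl l (Nat.lt_succ_self l))
    rw [← Set.ncard_coe_finset, ← Set.ncard_image_of_injective _ (finCongr hout.symm).injective]
    refine le_trans (Set.ncard_le_ncard (t := (Prod.fst '' {p : Fin (W (l + 1)) × Fin (W l) |
      A l p.1 p.2 ≠ 0}) ∪ {i | b l i ≠ 0}) ?_ (Set.toFinite _)) ((Set.ncard_union_le _ _).trans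
        (Nat.add_le_add_right (Set.ncard_image_le (Set.toFinite _)) _))
    rintro _ ⟨i, hi, rfl⟩
    simp only [Finset.coe_filter, Finset.mem_univ, true_and, Set.mem_ofPred_eq] at hi
    rcases hi with ⟨j, hj⟩ | hi
    · exact Or.inl ⟨(_, j), hj, rfl⟩
    · exact Or.inr hi
  · obtain ⟨l, rfl⟩ : ∃ l, L = l + 1 := ⟨L - 1, by omega⟩
    intro i hi x
    simp only [Finset.mem_filter, Finset.mem_univ, true_and, not_or, not_exists, not_not] at hi
    rw [hG]
    change neuron (A, b) (l + 1) _ _ = 0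
    rw [neuron_succ]
    obtain ⟨hA, hb⟩ := hi
    have hA' : ∀ j, A l (Fin.cast hout.symm i) j = 0 := hA
    have hb' : b l (Fin.cast hout.symm i) = 0 := hb
    simp [hA', hb']

end NetworkClass

/-- If the empirical target `s` is the self-normalized mean of the `x' j`, the error of a mean `v`
is controlled by its sampling error `‖e - v‖` and by the fluctuations of the weights. -/
lemma norm_sub_le_of_weights {n N : ℕ} (hN : 1 ≤ N) {v e m : Euc n} {x' : Fin N → Euc n}
    {w : Euc n → ℝ} {κ Z M : ℝ} (hκ : 0 < κ) (hZ : κ ≤ Z) (hM : ‖v - m‖ ≤ M)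
    (hmin : 0 < ∑ k, w (x' k) → ‖e - ∑ j, (w (x' j) / ∑ k, w (x' k)) • x' j‖ ≤
      ‖m - ∑ j, (w (x' j) / ∑ k, w (x' k)) • x' j‖) :
    ‖v - m‖ ≤ ‖e - v‖ + 4 / (N * κ) * ∑ k, |∑ j, w (x' j) * (x' j k - m k)| +
      M * (2 / (N * κ)) * |∑ j, (w (x' j) - Z)| := by
  have hN0 : (0 : ℝ) < N := by exact_mod_cast hN
  have hM0 : 0 ≤ M := (norm_nonneg _).trans hM
  have hs0 : 0 ≤ ∑ k, |∑ j, w (x' j) * (x' j k - m k)| :=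
    Finset.sum_nonneg fun _ _ => abs_nonneg _
  -- If the total weight reaches half of the lower bound `N * κ` for its mean, the denominator is
  -- harmless. Otherwise its fluctuation exceeds `N * κ / 2`, and the last term alone is at least
  -- `M`.
  rcases le_or_gt (N * κ / 2) (∑ k, w (x' k)) with h | h
  · have hpos : 0 < ∑ k, w (x' k) := lt_of_lt_of_le (by positivity) h
    have h1 := hmin hpos
    set s := ∑ j, (w (x' j) / ∑ k, w (x' k)) • x' j with hs
    have h2 : s - m = (∑ k, w (x' k))⁻¹ • ∑ j, w (x' j) • (x' j - m) := by
      simp only [smul_sub, Finset.sum_sub_distrib, ← Finset.sum_smul]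
      rw [smul_smul, inv_mul_cancel₀ hpos.ne', one_smul, hs, Finset.smul_sum]
      simp only [smul_smul, div_eq_inv_mul]
    have h3 : ‖s - m‖ ≤ 2 / (N * κ) * ∑ k, |∑ j, w (x' j) * (x' j k - m k)| := by
      rw [h2, norm_smul, norm_inv, Real.norm_of_nonneg hpos.le]
      refine mul_le_mul ?_ ?_ (norm_nonneg _) (by positivity)
      · rw [inv_le_comm₀ hpos (by positivity), inv_div]
        exact h
      · refine (norm_le_sum_abs _).trans (le_of_eq ?_)
        simp
    have h4 : ‖v - m‖ ≤ ‖e - v‖ + ‖e - s‖ + ‖s - m‖ := by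
      have : v - m = -(e - v) + (e - s) + (s - m) := by abel
      rw [this]
      refine (norm_add_le _ _).trans (add_le_add_left ((norm_add_le _ _).trans ?_) _)
      rw [norm_neg]
    -- By minimality `‖e - s‖` is bounded by `‖s - m‖`, which thus counts twice; this gives the 4 in
    -- the statement.
    rw [norm_sub_rev m s] at h1
    have h5 : 0 ≤ M * (2 / (N * κ)) * |∑ j, (w (x' j) - Z)| := by positivity
    have h6 : 4 / (N * κ) * ∑ k, |∑ j, w (x' j) * (x' j k - m k)| =
      2 * (2 / (N * κ) * ∑ k, |∑ j, w (x' j) * (x' j k - m k)|) := by ring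
    linarith
  · have h1 : N * κ / 2 ≤ |∑ j, (w (x' j) - Z)| := by
      refine le_trans ?_ (neg_le_abs _)
      simp only [Finset.sum_sub_distrib, Finset.sum_const, Finset.card_univ, Fintype.card_fin,
        nsmul_eq_mul]
      nlinarith
    have h2 : 1 ≤ 2 / (N * κ) * |∑ j, (w (x' j) - Z)| := by
      rw [div_mul_eq_mul_div, le_div_iff₀ (by positivity)]
      linarith
    have h3 : M ≤ M * (2 / (N * κ)) * |∑ j, (w (x' j) - Z)| := by
      rw [mul_assoc]
      exact le_mul_of_one_le_right hM0 h2
    have h4 : 0 ≤ 4 / (N * κ) * ∑ k, |∑ j, w (x' j) * (x' j k - m k)| := by positivity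
    linarith [norm_nonneg (e - v)]


/-- A bound for `‖∫ G dP - m‖ / n` over all networks `G`. -/
def biasConst (L S : ℕ) (R σ B κ : ℝ) : ℝ := S * affineIter (S * R) R σ L + B * σ / κ

/-- The constant in the error bound. -/
def errorConst (L S : ℕ) (R σ B κ : ℝ) : ℝ :=
  2 * S * affineIter (2 * (S * R)) R σ L / Real.log 2 +
    4 / κ * (2 * B * (σ + B * σ / κ)) + biasConst L S R σ B κ * (2 / κ) * B

lemma biasConst_nonneg (L S : ℕ) {R σ B κ : ℝ} (hR : 0 ≤ R) (hσ : 0 < σ) (hB : 0 < B)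
    (hκ : 0 < κ) : 0 ≤ biasConst L S R σ B κ := by
  have := affineIter_nonneg (by positivity : 0 ≤ S * R) hR hσ.le L
  unfold biasConst
  positivity

lemma error_terms_le (n L S : ℕ) {R σ B κ : ℝ} (hR : 0 ≤ R) (hσ : 0 < σ) (hB : 0 < B)
    (hκ : 0 < κ) {N₁ N₂ : ℕ} (hN₁ : 2 ≤ N₁) (hN₂ : 1 ≤ N₂) :
    S / N₁ * (2 * (n * Real.sqrt N₁ * affineIter (2 * (S * R)) R σ L)) +
      4 / (N₂ * κ) * (n * (Real.sqrt N₂ * (2 * B * (σ + B * σ / κ)))) +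
      n * biasConst L S R σ B κ * (2 / (N₂ * κ)) * (Real.sqrt N₂ * B) ≤
    errorConst L S R σ B κ * n * (Real.log N₁ / Real.sqrt N₁ + 1 / Real.sqrt N₂) := by
  have h1 : (0 : ℝ) < N₁ := by positivity
  have h2 : (0 : ℝ) < N₂ := by exact_mod_cast hN₂
  have hs1 : 0 < Real.sqrt N₁ := Real.sqrt_pos.2 h1
  have hs2 : 0 < Real.sqrt N₂ := Real.sqrt_pos.2 h2
  have hlog2 : 0 < Real.log 2 := Real.log_pos one_lt_two
  have hlog : Real.log 2 ≤ Real.log N₁ := Real.log_le_log two_pos (by exact_mod_cast hN₁)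
  have hK := affineIter_nonneg (by positivity : 0 ≤ 2 * (S * R)) hR hσ.le L
  have hb := biasConst_nonneg L S hR hσ hB hκ
  have q1 : Real.sqrt N₁ / N₁ = 1 / Real.sqrt N₁ := Real.sqrt_div_self'
  have q2 : Real.sqrt N₂ / N₂ = 1 / Real.sqrt N₂ := Real.sqrt_div_self'
  unfold errorConst
  generalize affineIter (2 * (S * R)) R σ L = K at *
  generalize biasConst L S R σ B κ = M at *
  set U := 2 * S * K / Real.log 2 with hU
  set V := 4 / κ * (2 * B * (σ + B * σ / κ)) + M * (2 / κ) * B with hV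
  have hU0 : 0 ≤ U := by positivity
  have hV0 : 0 ≤ V := by positivity
  -- The network term is of order `1/√N₁`; the factor `log N₁` is at least `log 2`, which explains
  -- the division by `log 2` in the constant.
  have e1 : S / N₁ * (2 * (n * Real.sqrt N₁ * K)) ≤ U * n * (Real.log N₁ / Real.sqrt N₁) := by
    have : S / N₁ * (2 * (n * Real.sqrt N₁ * K)) = U * n * (Real.log 2 * (1 / Real.sqrt N₁)) := by
      rw [← q1, hU]
      field_simp
    rw [this, ← mul_one_div (Real.log N₁)]
    gcongr
  have e2 : 4 / (N₂ * κ) * (n * (Real.sqrt N₂ * (2 * B * (σ + B * σ / κ)))) +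
      n * M * (2 / (N₂ * κ)) * (Real.sqrt N₂ * B) = V * n * (1 / Real.sqrt N₂) := by
    rw [← q2, hV]
    field_simp
  have e3 : 0 ≤ U * n * (1 / Real.sqrt N₂) := by positivity
  have e4 : 0 ≤ V * n * (Real.log N₁ / Real.sqrt N₁) := by
    have := hlog2.le.trans hlog
    positivity
  calc _ ≤ U * n * (Real.log N₁ / Real.sqrt N₁) + V * n * (1 / Real.sqrt N₂) := by linarith
    _ ≤ (U + V) * n * (Real.log N₁ / Real.sqrt N₁ + 1 / Real.sqrt N₂) := by
      have : (U + V) * n * (Real.log N₁ / Real.sqrt N₁ + 1 / Real.sqrt N₂) =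
        U * n * (Real.log N₁ / Real.sqrt N₁) + V * n * (1 / Real.sqrt N₂) +
        (U * n * (1 / Real.sqrt N₂) + V * n * (Real.log N₁ / Real.sqrt N₁)) := by ring
      linarith
    _ = _ := by rw [hV]; ring

lemma enorm_sub_le_of_coord_le {n N : ℕ} (hN : 1 ≤ N) {G : Euc n → Euc n} {x : Fin N → Euc n}
    {v : Euc n} {K : Finset (Fin n)} {F : ENNReal}
    (hK : ∀ k ∉ K, ((1 / (N : ℝ)) • ∑ i, G (x i) - v) k = 0)
    (hF : ∀ k, ‖∑ i, (G (x i) k - v k)‖ₑ ≤ F) {S : ℕ} (hS : K.card ≤ S) :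
    ‖(1 / (N : ℝ)) • ∑ i, G (x i) - v‖ₑ ≤ ENNReal.ofReal (S / N) * F := by
  have hN0 : (0 : ℝ) < N := by exact_mod_cast hN
  have h1 : ∀ k, ‖((1 / (N : ℝ)) • ∑ i, G (x i) - v) k‖ₑ ≤ ENNReal.ofReal (1 / N) * F := fun k => by
    have : ((1 / (N : ℝ)) • ∑ i, G (x i) - v) k = (1 / (N : ℝ)) * ∑ i, (G (x i) k - v k) := by
      simp [Finset.sum_sub_distrib, mul_sub, hN0.ne']
    rw [this, enorm_mul, Real.enorm_eq_ofReal (by positivity)]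
    gcongr
    exact hF k
  calc ‖(1 / (N : ℝ)) • ∑ i, G (x i) - v‖ₑ
      ≤ ∑ k, ‖((1 / (N : ℝ)) • ∑ i, G (x i) - v) k‖ₑ := by
        simp only [Real.enorm_eq_ofReal_abs]
        rw [← ENNReal.ofReal_sum_of_nonneg fun _ _ => abs_nonneg _, ← ofReal_norm]
        exact ENNReal.ofReal_le_ofReal (norm_le_sum_abs _)
    _ = ∑ k ∈ K, ‖((1 / (N : ℝ)) • ∑ i, G (x i) - v) k‖ₑ := by
      symm
      refine Finset.sum_subset (Finset.subset_univ _) fun k _ hk => ?_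
      rw [hK k hk, enorm_zero]
    _ ≤ K.card * (ENNReal.ofReal (1 / N) * F) := by
      refine (Finset.sum_le_sum fun k _ => h1 k).trans (le_of_eq ?_)
      rw [Finset.sum_const, nsmul_eq_mul]
    _ ≤ S * (ENNReal.ofReal (1 / N) * F) := by gcongr
    _ = ENNReal.ofReal (S / N) * F := by
      rw [← mul_assoc, ← ENNReal.ofReal_natCast, ← ENNReal.ofReal_mul (Nat.cast_nonneg _),
        mul_one_div]

/-- The error bound for a prior and a weight function with bounded moments. -/
theorem lintegral_norm_integral_map_sub_le {n L S : ℕ} (hn : 1 ≤ n) (hL : 1 ≤ L)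
    {R σ B κ : ℝ} (hκ : 0 < κ) (hB0 : 0 < B) {P Phat : Measure (Euc n)} [IsProbabilityMeasure P]
    [IsProbabilityMeasure Phat] (hP : IsSubGaussian P σ) (hPhat : IsSubGaussian Phat σ)
    {w : Euc n → ℝ} (hw : Measurable w) (h0 : ∀ x, 0 ≤ w x) (hB : ∀ x, w x ≤ B)
    (hκw : κ ≤ ∫ x, w x ∂P) {m : Euc n}
    (hm : ∀ k, m k = (∫ x, w x ∂P)⁻¹ * ∫ x, w x * x k ∂P) {c : ℝ} {𝓗 : Type*}
    [NormedAddCommGroup 𝓗] [InnerProductSpace ℝ 𝓗] [CompleteSpace 𝓗] [RKHS ℝ 𝓗 (Euc n) ℝ]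
    (hK : HasLinearKernel 𝓗 c) {W : ℕ → ℕ} (hmR : ∀ i, |m i| ≤ R)
    (hmS : {i | m i ≠ 0}.ncard ≤ S) {Ω : Type*} [MeasurableSpace Ω] {μ : Measure Ω}
    [IsProbabilityMeasure μ] {N₁ N₂ : ℕ} {X : Fin N₁ → Ω → Euc n} {X' : Fin N₂ → Ω → Euc n}
    (hN₁ : 2 ≤ N₁) (hN₂ : 1 ≤ N₂) (hX : iIndepFun X μ) (hXlaw : ∀ i, HasLaw (X i) Phat μ)
    (hX' : iIndepFun X' μ) (hXlaw' : ∀ j, HasLaw (X' j) P μ) {Ghat : Ω → Euc n → Euc n}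
    (hG : ∀ᵐ ω ∂μ, IsEmpiricalMinimizer (reluClass n L W S R) (rkhsUnitBall 𝓗)
      w (fun i => X i ω) (fun j => X' j ω) (Ghat ω)) :
    ∫⁻ ω, ENNReal.ofReal ‖(∫ x, x ∂(Phat.map (Ghat ω))) - m‖ ∂μ ≤
      ENNReal.ofReal (errorConst L S R σ B κ * n *
        (Real.log N₁ / Real.sqrt N₁ + 1 / Real.sqrt N₂)) := by
  have hσ := hP.1
  have hR : 0 ≤ R := (abs_nonneg _).trans (hmR ⟨0, hn⟩)
  have hρ : 0 ≤ S * R := by positivity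
  have hN₂0 : (0 : ℝ) < N₂ := by exact_mod_cast hN₂
  -- One realization of the minimizer shows that the class is nonempty, which forces the widths to
  -- match the dimension.
  obtain ⟨ω₀, hω₀⟩ := hG.exists
  obtain ⟨-, hin, hout, -⟩ := exists_netParams_of_mem_reluClass hL hω₀.1
  have hW0 : 1 ≤ W 0 := by omega
  let u : Euc n → Fin (W 0) → ℝ := fun x j => x (Fin.cast hin j)
  have hum : Measurable u := by fun_prop
  have hu : ∀ j, MemLp (fun x => u x j) 2 Phat := fun j =>
    (memLp_coord_of_isSubGaussian hPhat _).1
  have huσ : ∀ j, ∫ x, u x j ^ 2 ∂Phat ≤ σ ^ 2 := fun j =>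
    (memLp_coord_of_isSubGaussian hPhat _).2
  obtain ⟨F₁, hF₁m, hF₁, hF₁b⟩ := exists_measurable_bound_neuron (L := L) hum hu hσ huσ hρ hR hW0
    (by omega : 1 ≤ N₁)
  let F₂ : (Fin N₂ → Euc n) → ENNReal := fun x' =>
    ∑ k, ‖∑ j, w (x' j) * (x' j k - m k)‖ₑ
  let F₃ : (Fin N₂ → Euc n) → ENNReal := fun x' => ‖∑ j, (w (x' j) - ∫ z, w z ∂P)‖ₑ
  have hF₂m : Measurable F₂ := by fun_prop
  have hF₃m : Measurable F₃ := by fun_prop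
  have hF₂ : ∫⁻ x', F₂ x' ∂(Measure.pi fun _ : Fin N₂ => P) ≤
      ENNReal.ofReal (n * (Real.sqrt N₂ * (2 * B * (σ + B * σ / κ)))) := by
    rw [lintegral_finsetSum _ fun k _ => by fun_prop]
    refine (Finset.sum_le_sum fun k _ => lintegral_enorm_sum_weight_mul_sub_le hw h0 hB hB0 hκ hκw
      hσ (memLp_coord_of_isSubGaussian hP k).1 (memLp_coord_of_isSubGaussian hP k).2 (hm k)
      hN₂).trans (le_of_eq ?_)
    rw [Finset.sum_const, nsmul_eq_mul, Finset.card_univ, Fintype.card_fin,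
      ENNReal.ofReal_mul (Nat.cast_nonneg n), ENNReal.ofReal_natCast]
  have hF₃ : ∫⁻ x', F₃ x' ∂(Measure.pi fun _ : Fin N₂ => P) ≤ ENNReal.ofReal (Real.sqrt N₂ * B) :=
    lintegral_enorm_sum_weight_sub_le hw h0 hB hB0 hN₂
  have hconst : (fun _ => m) ∈ reluClass n L W S R := const_mem_reluClass hL hin hout hR hmR hmS
  have hM0 := biasConst_nonneg L S hR hσ hB0 hκ
  set M := n * biasConst L S R σ B κ with hMdef
  have hmnorm : ‖m‖ ≤ n * (B * σ / κ) := by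
    refine (norm_le_sum_abs m).trans ?_
    refine (Finset.sum_le_sum fun k _ => (hm k) ▸ abs_weighted_mean_le hw h0 hB hB0 hκ hκw hσ
      (memLp_coord_of_isSubGaussian hP k).1 (memLp_coord_of_isSubGaussian hP k).2).trans ?_
    simp
  -- `Ghat` need not be measurable in `ω`, so the error is dominated pointwise by measurable
  -- functions. Each involves one sample, so only the separate laws of the two samples matter.
  have hpt : ∀ᵐ ω ∂μ, ENNReal.ofReal ‖(∫ x, x ∂(Phat.map (Ghat ω))) - m‖ ≤
      ENNReal.ofReal (S / N₁) * F₁ (fun i => X i ω) +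
      ENNReal.ofReal (4 / (N₂ * κ)) * F₂ (fun j => X' j ω) +
      ENNReal.ofReal (M * (2 / (N₂ * κ))) * F₃ (fun j => X' j ω) := by
    filter_upwards [hG] with ω hω
    obtain ⟨θ, _, hout, K, hθ, hKS, hGθ, hGK⟩ := exists_netParams_of_mem_reluClass hL hω.1
    have hGc : ∀ k, (fun x => Ghat ω x k) = fun x => neuron θ L (Fin.cast hout.symm k) (u x) :=
      fun k => funext fun x => hGθ x k
    have hGi : ∀ k, Integrable (fun x => Ghat ω x k) Phat := fun k => by
      rw [hGc]
      exact integrable_neuron hum hu hρ hθ le_rfl _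
    have hGm : AEMeasurable (Ghat ω) Phat :=
      (integrable_of_coord hGi).aestronglyMeasurable.aemeasurable
    rw [integral_map (f := fun x : Euc n => x) hGm continuous_id.aestronglyMeasurable]
    set v := ∫ x, Ghat ω x ∂Phat with hv
    have hvk : ∀ k, v k = ∫ x, neuron θ L (Fin.cast hout.symm k) (u x) ∂Phat := fun k => by
      rw [hv, integral_coord hGi, hGc]
    have hvK : ∀ k ∉ K, v k = 0 := fun k hk => by
      rw [hv, integral_coord hGi]
      simp [hGK k hk]
    have hvnorm : ‖v‖ ≤ n * (S * affineIter (S * R) R σ L) := by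
      refine (norm_le_sum_abs v).trans ?_
      rw [← Finset.sum_subset (Finset.subset_univ K) fun k _ hk => by rw [hvK k hk, abs_zero]]
      have hb : ∀ k ∈ K, |v k| ≤ n * affineIter (S * R) R σ L := fun k _ => by
        have := abs_integral_neuron_le hum hu hσ huσ hρ hR hW0 hθ le_rfl (Fin.cast hout.symm k)
        rwa [← hvk, congrArg (Nat.cast (R := ℝ)) hin] at this
      refine (Finset.sum_le_sum hb).trans ?_
      have := affineIter_nonneg hρ hR hσ.le L
      rw [Finset.sum_const, nsmul_eq_mul, mul_left_comm]
      gcongr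
    have hvm : ‖v - m‖ ≤ M := by
      refine (norm_sub_le v m).trans ?_
      rw [hMdef, biasConst, mul_add]
      exact add_le_add hvnorm hmnorm
    have hdet := norm_sub_le_of_weights hN₂ hκ hκw hvm fun hpos =>
      norm_sub_le_of_isEmpiricalMinimizer hK (by omega) hω hconst hpos
    refine (ENNReal.ofReal_le_ofReal hdet).trans ?_
    have hs0 : 0 ≤ ∑ k, |∑ j, w (X' j ω) * (X' j ω k - m k)| :=
      Finset.sum_nonneg fun _ _ => abs_nonneg _
    rw [ENNReal.ofReal_add (by positivity) (by positivity),
      ENNReal.ofReal_add (by positivity) (by positivity), ENNReal.ofReal_mul (by positivity),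
      ENNReal.ofReal_mul (by positivity), ENNReal.ofReal_sum_of_nonneg fun _ _ => abs_nonneg _]
    simp only [← Real.enorm_eq_ofReal_abs]
    gcongr
    rw [ofReal_norm]
    refine enorm_sub_le_of_coord_le (by omega) (fun k hk => ?_) (fun k => ?_) hKS
    · simp [hvK k hk, hGK k hk]
    · have := hF₁b θ hθ (Fin.cast hout.symm k) fun i => X i ω
      rw [← hvk] at this
      refine le_trans (le_of_eq ?_) this
      simp only [hGθ]
      rfl
  have hlaw := iIndepFun.hasLaw_pi hXlaw hX
  have hlaw' := iIndepFun.hasLaw_pi hXlaw' hX'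
  have m1 : AEMeasurable (fun ω => F₁ fun i => X i ω) μ :=
    hF₁m.comp_aemeasurable hlaw.aemeasurable
  have m2 : AEMeasurable (fun ω => F₂ fun j => X' j ω) μ :=
    hF₂m.comp_aemeasurable hlaw'.aemeasurable
  have m3 : AEMeasurable (fun ω => F₃ fun j => X' j ω) μ :=
    hF₃m.comp_aemeasurable hlaw'.aemeasurable
  have hK1 := affineIter_nonneg (by positivity : 0 ≤ 2 * (S * R)) hR hσ.le L
  refine (lintegral_mono_ae hpt).trans ?_
  rw [lintegral_add_right' _ (m3.const_mul _), lintegral_add_right' _ (m2.const_mul _),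
    lintegral_const_mul' _ _ ENNReal.ofReal_ne_top, lintegral_const_mul' _ _ ENNReal.ofReal_ne_top,
    lintegral_const_mul' _ _ ENNReal.ofReal_ne_top, hlaw.lintegral_comp hF₁m.aemeasurable,
    hlaw'.lintegral_comp hF₂m.aemeasurable, hlaw'.lintegral_comp hF₃m.aemeasurable]
  rw [hin] at hF₁
  refine (add_le_add (add_le_add (mul_le_mul_right hF₁ _) (mul_le_mul_right hF₂ _))
    (mul_le_mul_right hF₃ _)).trans ?_
  rw [← ENNReal.ofReal_mul (by positivity), ← ENNReal.ofReal_mul (by positivity),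
    ← ENNReal.ofReal_mul (by positivity), ← ENNReal.ofReal_add (by positivity) (by positivity),
    ← ENNReal.ofReal_add (by positivity) (by positivity)]
  exact ENNReal.ofReal_le_ofReal (error_terms_le n L S hR hσ hB0 hκ hN₁ hN₂)

end

/-! ### Application to the state-space model -/

theorem proposition5 (L S : ℕ) (hL : 1 ≤ L) (R σ B κ : ℝ) (hκ : 0 < κ) :
    ∃ C : ℝ, 0 < C ∧
      ∀ (𝒮 : StateSpaceModel) (T : ℕ) (y : ∀ t, Euc (𝒮.dy t)) (a : ℕ → ℝ) (β : ℝ) (γ : ℕ → ℝ),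
      (∀ t, 0 < a t) →
      𝒮.RegularityAssumption T →
      𝒮.BoundedWeights y a T B →
      𝒮.FiniteNoiseVariance T →
      (∀ t ∈ Set.Icc 1 T, HasGradientBound (𝒮.weight y a t) β) →
      (∀ t ∈ Set.Icc 1 T, 0 < γ t ∧ IsStronglyLogConcave (𝒮.prior y t) (γ t)) →
      ∀ t ∈ Set.Icc 1 T,
      κ ≤ ∫ x, 𝒮.weight y a t x ∂𝒮.prior y t →
      -- the test functions: the unit ball of the linear reproducing kernel Hilbert space
      ∀ (c : ℝ) (𝓗 : Type*) [NormedAddCommGroup 𝓗] [InnerProductSpace ℝ 𝓗] [CompleteSpace 𝓗]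
        [RKHS ℝ 𝓗 (Euc (𝒮.dx t)) ℝ],
      HasLinearKernel 𝓗 c →
      (∀ f ∈ rkhsUnitBall 𝓗, HasGradientBound f β) →
      -- the estimated prior
      ∀ (Phat : Measure (Euc (𝒮.dx t))) [IsProbabilityMeasure Phat],
      IsSubGaussian Phat σ →
      IsSubGaussian (𝒮.prior y t) σ →
      -- the size of the network class
      ∀ (W : ℕ → ℕ),
      (∀ i, |(∫ z, z ∂𝒮.posterior y t) i| ≤ R) →
      {i | (∫ z, z ∂𝒮.posterior y t) i ≠ 0}.ncard ≤ S →
      -- the two samples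
      ∀ (Ω : Type*) [MeasurableSpace Ω] (μ : Measure Ω) [IsProbabilityMeasure μ]
        (N₁ N₂ : ℕ) (X : Fin N₁ → Ω → Euc (𝒮.dx t)) (X' : Fin N₂ → Ω → Euc (𝒮.dx t)),
      2 ≤ N₁ → 1 ≤ N₂ →
      iIndepFun X μ → (∀ i, HasLaw (X i) Phat μ) →
      iIndepFun X' μ → (∀ j, HasLaw (X' j) (𝒮.prior y t) μ) →
      -- the learned transformation
      ∀ (Ghat : Ω → Euc (𝒮.dx t) → Euc (𝒮.dx t)),
      (∀ᵐ ω ∂μ, IsEmpiricalMinimizer (reluClass (𝒮.dx t) L W S R) (rkhsUnitBall 𝓗)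
        (𝒮.weight y a t) (fun i => X i ω) (fun j => X' j ω) (Ghat ω)) →
      ∫⁻ ω, ENNReal.ofReal
          ‖(∫ x, x ∂(Phat.map (Ghat ω))) - ∫ z, z ∂𝒮.posterior y t‖ ∂μ ≤
        ENNReal.ofReal
          (C * (𝒮.dx t : ℝ) * (Real.log N₁ / Real.sqrt N₁ + 1 / Real.sqrt N₂)) := by
  -- The constant is chosen before any signs are known. The absolute values of `R`, `σ`, `B`
  -- disappear once the hypotheses show these to be nonnegative; adding 1 ensures positivity.
  refine ⟨|errorConst L S |R| |σ| |B| κ| + 1, by positivity, ?_⟩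
  intro 𝒮 T y a β γ ha _ hBw _ _ hslc t ht hκw c 𝓗 _ _ _ _ hK _ Phat _ hPhat hP W hmR hmS Ω _ μ _
    N₁ N₂ X X' hN₁ hN₂ hX hXlaw hX' hXlaw' Ghat hG
  have : IsProbabilityMeasure (𝒮.prior y t) := (hslc t ht).2.1
  obtain ⟨s, rfl⟩ : ∃ s, t = s + 1 := ⟨t - 1, by have := ht.1; omega⟩
  -- In dimension 0 the error vanishes; otherwise some coordinate exists, from which `0 ≤ R`
  -- follows.
  rcases Nat.eq_zero_or_pos (𝒮.dx (s + 1)) with hd | hd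
  · have : IsEmpty (Fin (𝒮.dx (s + 1))) := by rw [hd]; infer_instance
    have h0 : ∀ v : Euc (𝒮.dx (s + 1)), ‖v‖ = 0 := fun v => by
      rw [Subsingleton.elim v 0, norm_zero]
    simp [h0]
  have hℓm : Measurable (𝒮.likelihood y (s + 1)) :=
    (𝒮.density_pε (s + 1)).measurable.comp (measurable_const.sub (𝒮.measurable_H (s + 1)))
  have hℓ0 : ∀ x, 0 ≤ 𝒮.likelihood y (s + 1) x := fun x => (𝒮.density_pε (s + 1)).nonneg _
  have hwm : Measurable (𝒮.weight y a (s + 1)) := hℓm.const_mul _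
  have hw0 : ∀ x, 0 ≤ 𝒮.weight y a (s + 1) x := fun x => mul_nonneg (ha _).le (hℓ0 x)
  have hwB : ∀ x, 𝒮.weight y a (s + 1) x ≤ B := fun x =>
    (le_abs_self _).trans (hBw _ ht x)
  have hwi : Integrable (𝒮.weight y a (s + 1)) (𝒮.prior y (s + 1)) :=
    Integrable.of_bound hwm.aestronglyMeasurable B (.of_forall fun x => hBw _ ht x)
  have hBpos : 0 < B := by
    have : ∫ x, 𝒮.weight y a (s + 1) x ∂𝒮.prior y (s + 1) ≤ B := by
      simpa using integral_mono hwi (integrable_const B) hwB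
    linarith
  have hR : 0 ≤ R := (abs_nonneg _).trans (hmR ⟨0, hd⟩)
  have hm : ∀ k, (∫ z, z ∂𝒮.posterior y (s + 1)) k =
      (∫ x, 𝒮.weight y a (s + 1) x ∂𝒮.prior y (s + 1))⁻¹ *
        ∫ x, 𝒮.weight y a (s + 1) x * x k ∂𝒮.prior y (s + 1) :=
    integral_bayesUpdate_coord (ha (s + 1)) (fun _ => rfl) hℓm hℓ0 hwi fun k =>
      (memLp_weight_mul hwm hw0 hwB (memLp_coord_of_isSubGaussian hP k).1).integrable one_le_two
  refine (lintegral_norm_integral_map_sub_le hd hL hκ hBpos hP hPhat hwm hw0 hwB hκw hm hK hmR hmS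
    hN₁ hN₂ hX hXlaw hX' hXlaw' hG).trans (ENNReal.ofReal_le_ofReal ?_)
  rw [abs_of_nonneg hR, abs_of_pos hP.1, abs_of_pos hBpos]
  have hlog : 0 ≤ Real.log N₁ := Real.log_natCast_nonneg N₁
  gcongr
  exact (le_abs_self _).trans (le_add_of_nonneg_right zero_le_one)
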